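/- Let $L>0$, $\kappa>0$ and $\theta=\min\{\kappa/2,1\}$. Write $H^2\times H^1=H^2((0,L);\mathbb R^3)\times H^1((0,L);\mathbb R^3)$; its elements are pairs $(y,b)$, and $y,y',b$ are identified with their continuous representatives on $[0,L]$. Let $Y$ be a finite-dimensional real vector space, $\ell\in Y$, and let $L_{\rm bc}:H^2\times H^1\to Y$ be of the form $L_{\rm bc}[y,b]=\Lambda\big(y(0),y(L),y'(0),y'(L),b(0),b(L)\big)$ with $\Lambda:(\mathbb R^3)^6\to Y$ linear. Let $\mathcal A$ be the set of all $(y,b)\in H^2\times H^1$ with $L_{\rm bc}[y,b]=\ell$ and $|y'|=|b|=1$, $y'\cdot b=0$ on $[0,L]$. Define $$I_{\rm rod}[y,b]=\frac{\kappa}{2}\int_0^L|y''|^2\,dx+\frac12\int_0^L\big(b'\cdot(y'\times b)\big)^2\,dx\quad\text{if }(y,b)\in\mathcal A,\qquad I_{\rm rod}[y,b]=+\infty\quad\text{otherwise.}$$ For a partition of $[0,L]$ with nodes $\mathcal N_h=\{0=z_0<z_1<\dots<z_N=L\}$, whose mesh size is the maximal length of its elements $[z_{i-1},z_i]$, let $\mathcal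 A_h$ be the set of all $(y_h,b_h)\in H^2\times H^1$ such that, on every element, $y_h$ is a polynomial of degree at most $3$ and $b_h$ is a polynomial of degree at most $1$, and such that $L_{\rm bc}[y_h,b_h]=\ell$ and $|y_h'(z)|=|b_h(z)|=1$ for all $z\in\mathcal N_h$. Let $\mathcal I_h^{1,0}f$ denote the continuous, elementwise affine interpolant of a continuous function $f$ at the nodes, and let $Q_hv$ be the elementwise constant function whose value on each element is the mean value of $v$ over that element. For $\varepsilon>0$ define $$\begin{aligned}I_{\rm rod}^{h,\varepsilon}[y_h,b_h]={}&\frac{\kappa}{2}\int_0^L|y_h''|^2\,dx+\frac{\theta}{2}\int_0^L|b_h'|^2\,dx-\frac{\theta}{2}\int_0^L\big(Q_hb_h\cdot y_h''\big)^2\,dx\\&+\frac1{2\varepsilon}\int_0^L\mathcal I_h^{1,0}\big[(y_h'\cdot b_h)^2\big]\,dx+\frac{1-\theta}{2}\int_0^L\big(b_h'\cdot(y_h'\times Q_hb_h)\big)^2\,dx\end{aligned}$$ if $(y_h,b_h)\in\mathcal A_h$, and $I_{\rm rod}^{h,\varepsilon}=+\infty$ otherwise. **Proposition 4.1.** As $\varepsilon,h\searrow0$,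 with no restriction on the ratio of $\varepsilon$ and $h$, the functionals $I_{\rm rod}^{h,\varepsilon}$ Gamma-converge to $I_{\rm rod}$ with respect to the weak topology of $H^2\times H^1$. That is, for every sequence of partitions whose mesh sizes $h_n$ tend to $0$ and every sequence $\varepsilon_n>0$ with $\varepsilon_n\to0$ (the functional $I_{\rm rod}^{h_n,\varepsilon_n}$ being formed with the $n$-th partition and $\varepsilon_n$): 1. whenever $(y_n,b_n)\rightharpoonup(y,b)$ weakly in $H^2\times H^1$, then $I_{\rm rod}[y,b]\le\liminf_{n\to\infty}I_{\rm rod}^{h_n,\varepsilon_n}[y_n,b_n]$; 2. for every $(y,b)\in H^2\times H^1$ there is a sequence $(y_n,b_n)\rightharpoonup(y,b)$ weakly in $H^2\times H^1$ with $\limsup_{n\to\infty}I_{\rm rod}^{h_n,\varepsilon_n}[y_n,b_n]\le I_{\rm rod}[y,b]$. -/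

import Mathlib

open Set Filter Topology MeasureTheory
open scoped ContDiff ENNReal

noncomputable section

namespace Rod

/-- Euclidean three-space. -/
abbrev E : Type := EuclideanSpace ℝ (Fin 3)

/-- The vector cross product of `ℝ³`. -/
def cross (u v : E) : E := WithLp.toLp 2 (crossProduct u.ofLp v.ofLp)

/-! ### Sobolev spaces on the interval `(0, L)` -/

/-- Lebesgue measure on `(0, L)`. -/
abbrev intervalMeasure (L : ℝ) : Measure ℝ := volume.restrict (Ioo 0 L)

/-- The space `L²((0, L); ℝ³)`. -/
abbrev L2 (L : ℝ) : Type := Lp E 2 (intervalMeasure L)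

/-- `v` is the weak derivative of `u` on `(0, L)`: integration by parts holds against every
smooth real function with compact support in `(0, L)`. -/
def HasWeakDeriv (L : ℝ) (u v : ℝ → E) : Prop :=
  ∀ φ : ℝ → ℝ, ContDiff ℝ ∞ φ → HasCompactSupport φ → tsupport φ ⊆ Ioo 0 L →
    ∫ x, deriv φ x • u x ∂(intervalMeasure L) = - ∫ x, φ x • v x ∂(intervalMeasure L)

theorem integrable_L2 {L : ℝ} (u : L2 L) : Integrable u (intervalMeasure L) :=
  (Lp.memLp u).integrable (by norm_num)

theorem integrable_smul {L : ℝ} {u : ℝ → E} (hu : Integrable u (intervalMeasure L)) {φ : ℝ → ℝ}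
    (hφ : Continuous φ)
    (hc : HasCompactSupport φ) : Integrable (fun x => φ x • u x) (intervalMeasure L) := by
  obtain ⟨C, hC⟩ := hφ.bounded_above_of_compact_support hc
  exact hu.bdd_smul C hφ.aestronglyMeasurable (Eventually.of_forall hC)

theorem integrable_deriv_smul {L : ℝ} {u : ℝ → E} (hu : Integrable u (intervalMeasure L)) {φ : ℝ → ℝ}
    (hφ : ContDiff ℝ ∞ φ)
    (hc : HasCompactSupport φ) : Integrable (fun x => deriv φ x • u x) (intervalMeasure L) :=
  integrable_smul hu (hφ.continuous_deriv (by simp)) hc.deriv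

theorem HasWeakDeriv.congr_ae {L : ℝ} {u v u' v' : ℝ → E} (h : HasWeakDeriv L u v)
    (hu : u' =ᵐ[intervalMeasure L] u) (hv : v' =ᵐ[intervalMeasure L] v) :
    HasWeakDeriv L u' v' := by
  intro φ h1 h2 h3
  rw [integral_congr_ae (g := fun x => deriv φ x • u x) (hu.mono fun x hx => by simp only [hx]),
    integral_congr_ae (f := fun x => φ x • v' x) (g := fun x => φ x • v x) (hv.mono fun x hx => by simp only [hx])]
  exact h φ h1 h2 h3

theorem HasWeakDeriv.add {L : ℝ} {u v u' v' : ℝ → E} (h : HasWeakDeriv L u v)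
    (h' : HasWeakDeriv L u' v') (hu : Integrable u (intervalMeasure L))
    (hv : Integrable v (intervalMeasure L)) (hu' : Integrable u' (intervalMeasure L))
    (hv' : Integrable v' (intervalMeasure L)) : HasWeakDeriv L (u + u') (v + v') := by
  intro φ h1 h2 h3
  simp only [Pi.add_apply, smul_add]
  rw [integral_add (integrable_deriv_smul hu h1 h2) (integrable_deriv_smul hu' h1 h2),
    integral_add (integrable_smul hv h1.continuous h2) (integrable_smul hv' h1.continuous h2),
    h φ h1 h2 h3, h' φ h1 h2 h3, neg_add]

theorem HasWeakDeriv.const_smul {L : ℝ} {u v : ℝ → E} (h : HasWeakDeriv L u v) (c : ℝ) :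
    HasWeakDeriv L (c • u) (c • v) := by
  intro φ h1 h2 h3
  simp only [Pi.smul_apply, smul_comm _ c]
  rw [integral_smul, integral_smul, h φ h1 h2 h3, smul_neg]

/-- The Sobolev space `Hᵏ((0, L); ℝ³)`: a member `u` is recorded together with its weak derivatives
`u 0 = u`, `u 1 = u'`, …, `u k`, all in `L²`. As a subspace of the Hilbert sum of `k + 1` copies of
`L²` it carries the inner product `∑ j, ∫ u⁽ʲ⁾ · v⁽ʲ⁾`. -/
def Sobolev (L : ℝ) (k : ℕ) : Submodule ℝ (PiLp 2 (fun _ : Fin (k + 1) => L2 L)) where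
  carrier := {u | ∀ i : Fin k, HasWeakDeriv L (u i.castSucc) (u i.succ)}
  zero_mem' := by
    intro i
    have h : HasWeakDeriv L 0 0 := by
      intro φ _ _ _
      simp
    exact h.congr_ae (Lp.coeFn_zero E 2 _) (Lp.coeFn_zero E 2 _)
  add_mem' := by
    intro u v hu hv i
    exact ((hu i).add (hv i) (integrable_L2 _) (integrable_L2 _) (integrable_L2 _)
      (integrable_L2 _)).congr_ae (Lp.coeFn_add _ _) (Lp.coeFn_add _ _)
  smul_mem' := by
    intro c u hu i
    exact ((hu i).const_smul c).congr_ae (Lp.coeFn_smul _ _) (Lp.coeFn_smul _ _)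

theorem exists_Icc_of_compact {L : ℝ} (hL : 0 < L) {K : Set ℝ} (hK : IsCompact K)
    (h : K ⊆ Ioo 0 L) : ∃ a b, 0 < a ∧ a ≤ b ∧ b < L ∧ K ⊆ Icc a b := by
  rcases K.eq_empty_or_nonempty with rfl | hne
  · exact ⟨L / 2, L / 2, by linarith, le_rfl, by linarith, by simp⟩
  · exact ⟨sInf K, sSup K, (h (hK.sInf_mem hne)).1,
      csInf_le_csSup hne hK.bddBelow hK.bddAbove, (h (hK.sSup_mem hne)).2,
      fun x hx => ⟨csInf_le hK.bddBelow hx, le_csSup hK.bddAbove hx⟩⟩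

theorem exists_primitive {L : ℝ} (hL : 0 < L) {g : ℝ → ℝ} (hg : ContDiff ℝ ∞ g)
    (hc : HasCompactSupport g) (hs : tsupport g ⊆ Ioo 0 L) (h0 : ∫ x, g x = 0) :
    ∃ G : ℝ → ℝ, ContDiff ℝ ∞ G ∧ HasCompactSupport G ∧ tsupport G ⊆ Ioo 0 L ∧
      deriv G = g := by
  obtain ⟨a, b, ha, hab, hb, hK⟩ := exists_Icc_of_compact hL hc hs
  have hz : ∀ x, x ∉ Icc a b → g x = 0 := fun x hx =>
    image_eq_zero_of_notMem_tsupport fun h => hx (hK h)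
  have hd : ∀ x, HasDerivAt (fun x => ∫ t in a..x, g t) (g x) x := fun x =>
    intervalIntegral.integral_hasDerivAt_right (hg.continuous.intervalIntegrable _ _)
      (hg.continuous.stronglyMeasurableAtFilter _ _) hg.continuous.continuousAt
  have hder : deriv (fun x => ∫ t in a..x, g t) = g := funext fun x => (hd x).deriv
  have hsub : Function.support (fun x => ∫ t in a..x, g t) ⊆ Icc a b := by
    intro x hx
    by_contra hx'
    apply hx
    rcases lt_or_ge x a with h | h
    · show ∫ t in a..x, g t = 0
      rw [intervalIntegral.integral_symm, neg_eq_zero]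
      refine intervalIntegral.integral_zero_ae ?_
      have := (compl_mem_ae_iff (μ := (volume : Measure ℝ)) (s := {a})).2 (by simp)
      filter_upwards [this] with t ht ht'
      rw [uIoc_of_le h.le] at ht'
      exact hz t fun h' => ht (le_antisymm ht'.2 h'.1)
    · have hbx : b < x := by
        by_contra h'
        exact hx' ⟨h, not_lt.1 h'⟩
      show ∫ t in a..x, g t = 0
      rw [← h0, intervalIntegral.integral_of_le h, ← integral_Icc_eq_integral_Ioc]
      refine setIntegral_eq_integral_of_forall_compl_eq_zero fun t ht => hz t fun h' => ht ?_
      exact ⟨h'.1, h'.2.trans hbx.le⟩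
  have hts : tsupport (fun x => ∫ t in a..x, g t) ⊆ Icc a b :=
    closure_minimal hsub isClosed_Icc
  refine ⟨_, ?_, ?_, hts.trans fun x hx => ⟨ha.trans_le hx.1, hx.2.trans_lt hb⟩, hder⟩
  · rw [contDiff_infty_iff_deriv]
    exact ⟨fun x => (hd x).differentiableAt, by rw [hder]; exact hg⟩
  · exact isCompact_Icc.of_isClosed_subset (isClosed_tsupport _) hts

theorem exists_unit_bump {L : ℝ} (hL : 0 < L) : ∃ ψ : ℝ → ℝ, ContDiff ℝ ∞ ψ ∧
    HasCompactSupport ψ ∧ tsupport ψ ⊆ Ioo 0 L ∧ ∫ x, ψ x = 1 := by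
  let B : ContDiffBump (L / 2 : ℝ) := ⟨L / 8, L / 4, by linarith, by linarith⟩
  refine ⟨B.normed volume, B.contDiff_normed, B.hasCompactSupport_normed, ?_, B.integral_normed⟩
  rw [B.tsupport_normed_eq, Real.closedBall_eq_Icc]
  intro x hx
  simp only [mem_Icc, B] at hx
  constructor <;> linarith [hx.1, hx.2]

theorem setIntegral_of_tsupport {L : ℝ} {F : Type*} [NormedAddCommGroup F] [NormedSpace ℝ F]
    {g : ℝ → ℝ} (hs : tsupport g ⊆ Ioo 0 L) (w : ℝ → F) :
    ∫ x, g x • w x ∂(intervalMeasure L) = ∫ x, g x • w x :=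
  setIntegral_eq_integral_of_forall_compl_eq_zero fun x hx => by
    rw [image_eq_zero_of_notMem_tsupport fun h => hx (hs h), zero_smul]

/-- A function with vanishing weak derivative is constant. -/
theorem ae_const_of_weakDeriv_zero {L : ℝ} (hL : 0 < L) {w : ℝ → E}
    (hw : Integrable w (intervalMeasure L)) (h : HasWeakDeriv L w 0) :
    ∃ c : E, ∀ᵐ x ∂(intervalMeasure L), w x = c := by
  obtain ⟨ψ, h1, h2, h3, h4⟩ := exists_unit_bump hL
  refine ⟨∫ x, ψ x • w x ∂(intervalMeasure L), ?_⟩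
  set c := ∫ x, ψ x • w x ∂(intervalMeasure L) with hc
  have key := IsOpen.ae_eq_zero_of_integral_contDiff_smul_eq_zero (μ := (volume : Measure ℝ))
    (f := fun x => w x - c) (U := Ioo 0 L) isOpen_Ioo ?_ ?_
  · rw [ae_restrict_iff' measurableSet_Ioo]
    filter_upwards [key] with x hx hx'
    exact sub_eq_zero.1 (hx hx')
  · exact IntegrableOn.locallyIntegrableOn (hw.sub (integrable_const c))
  · intro g g1 g2 g3
    have gc : Integrable g := g1.continuous.integrable_of_hasCompactSupport g2
    have pc : Integrable ψ := h1.continuous.integrable_of_hasCompactSupport h2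
    obtain ⟨G, G1, G2, G3, G4⟩ := exists_primitive hL (g := fun x => g x - (∫ y, g y) * ψ x)
      (g1.sub (contDiff_const.mul h1)) (g2.sub h2.mul_left)
      ((tsupport_sub _ _).trans (union_subset g3 ((tsupport_mul_subset_right).trans h3)))
      (by rw [integral_sub gc (pc.const_mul _), integral_const_mul, h4]; simp)
    have e := h G G1 G2 G3
    rw [G4] at e
    simp only [Pi.zero_apply, smul_zero, integral_zero, neg_zero, sub_smul, mul_smul] at e
    rw [integral_sub (integrable_smul hw g1.continuous g2)
      ((integrable_smul hw h1.continuous h2).fun_smul _), integral_smul, ← hc] at e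
    rw [← setIntegral_of_tsupport g3]
    simp only [smul_sub]
    rw [integral_sub (integrable_smul hw g1.continuous g2)
      (integrable_smul (integrable_const c) g1.continuous g2), integral_smul_const]
    have : ∫ x, g x ∂(intervalMeasure L) = ∫ x, g x := by
      simpa using setIntegral_of_tsupport g3 (fun _ => (1 : ℝ))
    rw [this]
    exact e

theorem scalar_parts {L : ℝ} (hL : 0 < L) {v : ℝ → ℝ} (hv : Integrable v (intervalMeasure L))
    {φ : ℝ → ℝ} (h1 : ContDiff ℝ ∞ φ) (h3 : tsupport φ ⊆ Ioo 0 L) :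
    ∫ x, deriv φ x * (∫ t in 0..x, v t) ∂(intervalMeasure L)
      = - ∫ x, φ x * v x ∂(intervalMeasure L) := by
  have hi : IntervalIntegrable v volume 0 L := by
    rw [intervalIntegrable_iff_integrableOn_Ioo_of_le hL.le]; exact hv
  have hz : ∀ x, x ∉ Ioo 0 L → φ x = 0 := fun x hx =>
    image_eq_zero_of_notMem_tsupport fun h => hx (h3 h)
  have hF := hi.absolutelyContinuousOnInterval_intervalIntegral (c := 0) (by simp)
  have hφ : AbsolutelyContinuousOnInterval φ 0 L :=
    (h1.of_le (by simp)).contDiffOn.absolutelyContinuousOnInterval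
  have := hF.integral_mul_deriv_eq_deriv_mul hφ
  rw [hz 0 (by simp), hz L (by simp)] at this
  have hd : ∀ᵐ x ∂(intervalMeasure L), deriv (fun x => ∫ t in 0..x, v t) x = v x := by
    rw [ae_restrict_iff' measurableSet_Ioo]
    filter_upwards [hi.ae_hasDerivAt_integral] with x hx hx'
    refine (hx ?_ 0 (by simp)).deriv
    rw [uIcc_of_le hL.le]
    exact Ioo_subset_Icc_self hx'
  simp only [mul_zero, sub_zero, zero_sub] at this
  rw [intervalIntegral.integral_of_le hL.le, integral_Ioc_eq_integral_Ioo,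
    intervalIntegral.integral_of_le hL.le, integral_Ioc_eq_integral_Ioo] at this
  rw [integral_congr_ae (g := fun x => (∫ t in 0..x, v t) * deriv φ x)
    (Eventually.of_forall fun x => mul_comm _ _), this, neg_inj]
  exact integral_congr_ae (hd.mono fun x hx => by simp only [hx, mul_comm])

theorem hasWeakDeriv_primitive {L : ℝ} (hL : 0 < L) {v : ℝ → E}
    (hv : Integrable v (intervalMeasure L)) (hF : Integrable (fun x => ∫ t in 0..x, v t) (intervalMeasure L)) :
    HasWeakDeriv L (fun x => ∫ t in 0..x, v t) v := by
  intro φ h1 h2 h3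
  ext i
  have hp : ∀ f : ℝ → E, Integrable f (intervalMeasure L) →
      (∫ x, f x ∂(intervalMeasure L)) i = ∫ x, f x i ∂(intervalMeasure L) := fun f hf =>
    ((EuclideanSpace.proj (𝕜 := ℝ) i).integral_comp_comm hf).symm
  rw [PiLp.neg_apply, hp _ (integrable_deriv_smul hF h1 h2),
    hp _ (integrable_smul hv h1.continuous h2)]
  have hvi : Integrable (fun x => v x i) (intervalMeasure L) :=
    (EuclideanSpace.proj (𝕜 := ℝ) i).integrable_comp hv
  rw [show (∫ x, (φ x • v x) i ∂(intervalMeasure L)) = ∫ x, φ x * v x i ∂(intervalMeasure L) from rfl,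
    ← scalar_parts hL hvi h1 h3]
  refine setIntegral_congr_fun measurableSet_Ioo fun x hx => ?_
  have hx' : Integrable v (volume.restrict (Ioc 0 x)) :=
    IntegrableOn.mono_set (t := Ioo 0 L) hv fun t ht => ⟨ht.1, ht.2.trans_lt hx.2⟩
  simp only [PiLp.smul_apply, smul_eq_mul, intervalIntegral.integral_of_le hx.1.le]
  exact congrArg (deriv φ x * ·)
    ((EuclideanSpace.proj (𝕜 := ℝ) i).integral_comp_comm hx').symm

/-- Sobolev embedding in dimension one. -/
theorem exists_continuous_rep {L : ℝ} {u v : ℝ → E} (hu : Integrable u (intervalMeasure L))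
    (hv : Integrable v (intervalMeasure L)) (h : HasWeakDeriv L u v) :
    ∃ f : ℝ → E, Continuous f ∧ u =ᵐ[intervalMeasure L] f := by
  rcases le_or_gt L 0 with hL | hL
  · refine ⟨fun _ => 0, continuous_const, ?_⟩
    have : intervalMeasure L = 0 := by
      rw [intervalMeasure, Ioo_eq_empty (not_lt.2 hL), Measure.restrict_empty]
    rw [this]; simp [EventuallyEq]
  let V : ℝ → E := (Ioo 0 L).indicator v
  have hV : Integrable V := (integrable_indicator_iff measurableSet_Ioo).2 hv
  have hVv : v =ᵐ[intervalMeasure L] V := (indicator_ae_eq_restrict measurableSet_Ioo).symm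
  have hcont : Continuous (fun x => ∫ t in 0..x, V t) :=
    intervalIntegral.continuous_primitive (fun a b => hV.intervalIntegrable) 0
  have hFi : Integrable (fun x => ∫ t in 0..x, V t) (intervalMeasure L) :=
    (hcont.continuousOn.integrableOn_compact (isCompact_Icc (a := 0) (b := L))).mono_set
      Ioo_subset_Icc_self
  have hF := hasWeakDeriv_primitive hL hV.restrict hFi
  have hw : HasWeakDeriv L (u + (-1 : ℝ) • fun x => ∫ t in 0..x, V t) 0 := by
    refine (h.add (hF.const_smul (-1)) hu hv (hFi.smul _) (hV.restrict.smul _)).congr_ae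
      (EventuallyEq.refl _ _) ?_
    filter_upwards [hVv] with x hx
    simp [hx]
  obtain ⟨c, hc⟩ := ae_const_of_weakDeriv_zero hL (hu.add (hFi.smul _)) hw
  refine ⟨fun x => c + ∫ t in 0..x, V t, continuous_const.add hcont, ?_⟩
  filter_upwards [hc] with x hx
  rw [← hx]
  simp

/-- The `j`-th weak derivative of `u ∈ Hᵏ`, `0 ≤ j ≤ k` (defined almost everywhere). -/
def weakD {L : ℝ} {k : ℕ} (u : Sobolev L k) (j : Fin (k + 1)) : ℝ → E := (u.1 j : L2 L)

theorem exists_rep {L : ℝ} {k : ℕ} (u : Sobolev L k) (j : Fin k) :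
    ∃ f : ℝ → E, Continuous f ∧ weakD u j.castSucc =ᵐ[intervalMeasure L] f :=
  exists_continuous_rep (integrable_L2 _) (integrable_L2 _) (u.2 j)

/-- The continuous representative of the `j`-th weak derivative of `u ∈ Hᵏ`, `0 ≤ j < k`. It is
uniquely determined on `[0, L]` if `0 < L`; its values outside `[0, L]` are never used. -/
def rep {L : ℝ} {k : ℕ} (u : Sobolev L k) (j : Fin k) : ℝ → E := (exists_rep u j).choose

theorem continuous_rep {L : ℝ} {k : ℕ} (u : Sobolev L k) (j : Fin k) : Continuous (rep u j) :=
  (exists_rep u j).choose_spec.1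

theorem weakD_ae_eq_rep {L : ℝ} {k : ℕ} (u : Sobolev L k) (j : Fin k) :
    weakD u j.castSucc =ᵐ[intervalMeasure L] rep u j :=
  (exists_rep u j).choose_spec.2

/-- The space `H² × H¹` of pairs (centerline `y`, director `b`). -/
abbrev RodSpace (L : ℝ) : Type := Sobolev L 2 × Sobolev L 1

namespace RodSpace

variable {L : ℝ} (p : RodSpace L)

/-- The centerline `y` (continuous representative). -/
def y : ℝ → E := rep p.1 0

/-- The derivative `y'` (continuous representative). -/
def dy : ℝ → E := rep p.1 1

/-- The second weak derivative `y''`. -/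
def ddy : ℝ → E := weakD p.1 2

/-- The director `b` (continuous representative). -/
def b : ℝ → E := rep p.2 0

/-- The weak derivative `b'`. -/
def db : ℝ → E := weakD p.2 1

end RodSpace

/-! ### The continuous functional -/

/-- The boundary points `y(0), y(L), y'(0), y'(L), b(0), b(L)`. -/
def boundaryPoints {L : ℝ} (p : RodSpace L) : Fin 6 → E :=
  ![RodSpace.y p 0, RodSpace.y p L, RodSpace.dy p 0, RodSpace.dy p L, RodSpace.b p 0,
    RodSpace.b p L]

/-- The admissible class `𝒜`: boundary conditions `Λ (boundary points) = ℓ`, and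
`|y'| = |b| = 1`, `y' ⟂ b` on `[0, L]`. -/
def Admissible {L : ℝ} {Y : Type*} [AddCommGroup Y] [Module ℝ Y]
    (Λ : (Fin 6 → E) →ₗ[ℝ] Y) (ℓ : Y) : Set (RodSpace L) :=
  {p | Λ (boundaryPoints p) = ℓ ∧ ∀ x ∈ Icc 0 L,
    ‖RodSpace.dy p x‖ = 1 ∧ ‖RodSpace.b p x‖ = 1 ∧ inner ℝ (RodSpace.dy p x) (RodSpace.b p x) = 0}

/-- `κ/2 ∫ |y''|² + 1/2 ∫ (b' · (y' × b))²`. -/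
def rodEnergy {L : ℝ} (κ : ℝ) (p : RodSpace L) : ℝ :=
  κ / 2 * (∫ x in Ioo 0 L, ‖RodSpace.ddy p x‖ ^ 2)
    + 1 / 2 * (∫ x in Ioo 0 L,
        inner ℝ (RodSpace.db p x) (cross (RodSpace.dy p x) (RodSpace.b p x)) ^ 2)

open Classical in
/-- The bending-torsion functional, with the value `+∞` outside of the admissible class. -/
def Irod {L : ℝ} {Y : Type*} [AddCommGroup Y] [Module ℝ Y] (κ : ℝ)
    (Λ : (Fin 6 → E) →ₗ[ℝ] Y) (ℓ : Y) (p : RodSpace L) : EReal :=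
  if p ∈ Admissible Λ ℓ then (rodEnergy κ p : EReal) else ⊤

/-! ### Discretization -/

/-- A partition `0 = z₀ < z₁ < … < z_N = L` of `[0, L]`. -/
structure Partition (L : ℝ) where
  /-- number of elements -/
  N : ℕ
  /-- the nodes -/
  node : Fin (N + 1) → ℝ
  strictMono : StrictMono node
  node_zero : node 0 = 0
  node_last : node (Fin.last N) = L

namespace Partition

variable {L : ℝ} (P : Partition L)

/-- Left endpoint of the `i`-th element. -/
def left (i : Fin P.N) : ℝ := P.node i.castSucc

/-- Right endpoint of the `i`-th element. -/
def right (i : Fin P.N) : ℝ := P.node i.succ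

/-- The mesh size: the largest length of an element. -/
def mesh : ℝ := ⨆ i : Fin P.N, (P.right i - P.left i)

/-- On every (closed) element, `f` is a polynomial of degree at most `d` with coefficients in
`ℝ³`. -/
def IsPiecewisePoly (d : ℕ) (f : ℝ → E) : Prop :=
  ∀ i : Fin P.N, ∃ c : Fin (d + 1) → E, ∀ x ∈ Icc (P.left i) (P.right i),
    f x = ∑ k : Fin (d + 1), x ^ (k : ℕ) • c k

/-- The nodal basis function `φ_j` of the continuous piecewise affine functions: `φ_j (z_j) = 1`,
`φ_j` vanishes at the other nodes and is affine on every element. -/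
def hat (j : Fin (P.N + 1)) (x : ℝ) : ℝ :=
  if x = P.node j then 1
  else ∑ i : Fin P.N, (Ioo (P.left i) (P.right i)).indicator
    (fun t => if j = i.castSucc then (P.right i - t) / (P.right i - P.left i)
      else if j = i.succ then (t - P.left i) / (P.right i - P.left i) else 0) x

/-- The nodal interpolation operator `𝓘^{1,0}` of scalar functions. -/
def interp (f : ℝ → ℝ) (x : ℝ) : ℝ := ∑ j, f (P.node j) * P.hat j x

/-- The averaging operator `Q`: on every open element, the mean value over that element (its
values at the finitely many nodes are irrelevant). -/
def avg (v : ℝ → E) (x : ℝ) : E :=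
  ∑ i : Fin P.N, (Ioo (P.left i) (P.right i)).indicator
    (fun _ => (P.right i - P.left i)⁻¹ • ∫ ξ in (P.left i)..(P.right i), v ξ) x

end Partition

/-- The finite element space: piecewise cubic `y ∈ H²` and piecewise linear `b ∈ H¹`. -/
def discreteSpace {L : ℝ} (P : Partition L) : Set (RodSpace L) :=
  {p | P.IsPiecewisePoly 3 (RodSpace.y p) ∧ P.IsPiecewisePoly 1 (RodSpace.b p)}

/-- The discrete admissible class `𝒜_h`: the boundary conditions hold, and the unit length
constraints are imposed at the nodes only. -/
def DiscreteAdmissible {L : ℝ} {Y : Type*} [AddCommGroup Y] [Module ℝ Y]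
    (Λ : (Fin 6 → E) →ₗ[ℝ] Y) (ℓ : Y) (P : Partition L) : Set (RodSpace L) :=
  {p | p ∈ discreteSpace P ∧ Λ (boundaryPoints p) = ℓ ∧
    ∀ j, ‖RodSpace.dy p (P.node j)‖ = 1 ∧ ‖RodSpace.b p (P.node j)‖ = 1}

/-- `θ = min {κ/2, 1}`. -/
def theta (κ : ℝ) : ℝ := min (κ / 2) 1

/-- The discrete energy `κ/2 ∫ |y''|² + θ/2 ∫ |b'|² - θ/2 ∫ (Q b · y'')²
+ 1/(2ε) ∫ 𝓘^{1,0}[(y' · b)²] + (1-θ)/2 ∫ (b' · (y' × Q b))²`. -/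
def discreteEnergy {L : ℝ} (κ : ℝ) (P : Partition L) (ε : ℝ) (p : RodSpace L) : ℝ :=
  κ / 2 * (∫ x in Ioo 0 L, ‖RodSpace.ddy p x‖ ^ 2)
    + theta κ / 2 * (∫ x in Ioo 0 L, ‖RodSpace.db p x‖ ^ 2)
    - theta κ / 2 * (∫ x in Ioo 0 L, inner ℝ (P.avg (RodSpace.b p) x) (RodSpace.ddy p x) ^ 2)
    + 1 / (2 * ε) * (∫ x in Ioo 0 L,
        P.interp (fun t => inner ℝ (RodSpace.dy p t) (RodSpace.b p t) ^ 2) x)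
    + (1 - theta κ) / 2 * (∫ x in Ioo 0 L,
        inner ℝ (RodSpace.db p x) (cross (RodSpace.dy p x) (P.avg (RodSpace.b p) x)) ^ 2)

open Classical in
/-- The discrete penalized functional, with the value `+∞` outside of the discrete admissible
class. -/
def IrodDiscrete {L : ℝ} {Y : Type*} [AddCommGroup Y] [Module ℝ Y] (κ : ℝ)
    (Λ : (Fin 6 → E) →ₗ[ℝ] Y) (ℓ : Y) (P : Partition L) (ε : ℝ) (p : RodSpace L) : EReal :=
  if p ∈ DiscreteAdmissible Λ ℓ P then (discreteEnergy κ P ε p : EReal) else ⊤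

/-! ### Gamma-convergence -/

/-- (Sequential) Gamma-convergence of `F n` to `G` on a topological space: the lim-inf inequality
along all convergent sequences, and the existence of recovery sequences. -/
def GammaConverges {X : Type*} [TopologicalSpace X] (F : ℕ → X → EReal) (G : X → EReal) : Prop :=
  (∀ (x : X) (u : ℕ → X), Tendsto u atTop (𝓝 x) →
    G x ≤ liminf (fun n => F n (u n)) atTop) ∧
  (∀ x : X, ∃ u : ℕ → X, Tendsto u atTop (𝓝 x) ∧
    limsup (fun n => F n (u n)) atTop ≤ G x)

end Rod

end

/-!
The proof rests on two facts. For a rod with `|y'| = |b| = 1` and `y' · b = 0`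
differentiating the constraints gives `b · b' = 0` and `y' · b' = - b · y''`, so in the
orthonormal frame `y'`, `b`, `y' × b` one has `|b'|² = (b · y'')² + (b' · (y' × b))²`
(`Rod.norm_db_sq_eq`). The `θ`-terms of the discrete energy without the penalty therefore combine
in the limit to the bending-torsion energy (`Rod.rodEnergy_eq`). Secondly, `θ ≤ κ/2` and `|Q b| ≤
1` make `κ/2 |v|² - θ/2 (Q b · v)²` a nonnegative, hence convex, quadratic form, and `θ ≤ 1` makes
the remaining terms convex.

*Lower bound* (`Rod.admissible_and_rodEnergy_le`). Weak convergence in `H² × H¹` implies uniform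
convergence of `y'` and `b` (`Rod.tendstoUniformlyOn_rep`), so that boundary conditions and the
nodal constraint on the lengths pass to the limit, and the penalty, which is at most `2 ε` times a
bound of the energies, forces `y' · b = 0`. Since `Q b` and `y' × Q b` converge uniformly, the
operators `v ↦ Q b · v` and `w ↦ (y' × Q b) · w` from `L²(ℝ³)` to `L²(ℝ)` converge in operator
norm, and the convex quadratic forms built from them are weakly lower semicontinuous
(`Rod.WeakTendsto.exists_lower_bound_sub`, `Rod.WeakTendsto.exists_lower_bound_map`).

*Recovery sequences* (`Rod.interpolant`). The `L²`-projections of `y''` onto elementwise affine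
functions and of `b'` onto elementwise constant functions are integrated with the given initial
values. Orthogonality shows that `y'` and `b` are unchanged at the nodes, and that `y` is
unchanged at the end points. Hence boundary conditions and nodal constraints hold exactly and the
penalty vanishes, independently of `ε`; the projections converge strongly (`Rod.tendsto_proj`),
and so do the energies.
-/

noncomputable section

namespace Rod

variable {L : ℝ}

/-! ### Square-integrable functions and their primitives -/

theorem eqOn_Icc_of_ae_eq_Ioo (hL : 0 < L) {F : Type*} [TopologicalSpace F] [T2Space F]
    {f g : ℝ → F}
    (hf : ContinuousOn f (Icc 0 L)) (hg : ContinuousOn g (Icc 0 L))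
    (h : f =ᵐ[intervalMeasure L] g) :
    EqOn f g (Icc 0 L) := by
  have h1 : EqOn f g (Ioo 0 L) := Measure.eqOn_Ioo_of_ae_eq volume h
    (hf.mono Ioo_subset_Icc_self) (hg.mono Ioo_subset_Icc_self)
  exact h1.of_subset_closure hf hg Ioo_subset_Icc_self (by rw [closure_Ioo hL.ne])

/-- Cauchy–Schwarz against the indicator function of `s`. -/
theorem norm_setIntegral_le_sqrt_mul_norm {α : Type*} [MeasurableSpace α] {μ : Measure α}
    [IsFiniteMeasure μ] (g : Lp E 2 μ) {s : Set α} (hs : MeasurableSet s) :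
    ‖∫ x in s, g x ∂μ‖ ≤ √(μ.real s) * ‖g‖ := by
  set c := ∫ x in s, g x ∂μ with hc
  have h := L2.inner_indicatorConstLp_eq_inner_setIntegral ℝ hs (measure_ne_top μ s) c g
  have h2 := real_inner_le_norm (indicatorConstLp 2 hs (measure_ne_top μ s) c) g
  rw [h, ← hc, norm_indicatorConstLp (by simp) (by simp), real_inner_self_eq_norm_sq] at h2
  have e : μ.real s ^ (1 / (2 : ℝ≥0∞).toReal) = √(μ.real s) := by
    rw [Real.sqrt_eq_rpow]; norm_num
  rw [e] at h2
  rcases eq_or_ne ‖c‖ 0 with h0 | h0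
  · rw [h0]; positivity
  · have : 0 < ‖c‖ := lt_of_le_of_ne (norm_nonneg _) h0.symm
    nlinarith

theorem intervalIntegral_eq_setIntegral_Ioo (g : ℝ → E) {s x : ℝ} (h0 : 0 ≤ s) (hsx : s ≤ x)
    (hx : x ≤ L) :
    ∫ t in s..x, g t = ∫ t in Ioo s x, g t ∂(intervalMeasure L) := by
  rw [intervalIntegral.integral_of_le hsx, integral_Ioc_eq_integral_Ioo,
    Measure.restrict_restrict measurableSet_Ioo,
    inter_eq_left.2 (Ioo_subset_Ioo h0 hx)]

theorem intervalIntegrable_of_integrable {F : Type*} [NormedAddCommGroup F] {g : ℝ → F}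
    (hg : Integrable g (intervalMeasure L))
    {s x : ℝ} (hs : s ∈ Icc 0 L) (hx : x ∈ Icc 0 L) : IntervalIntegrable g volume s x := by
  have : IntervalIntegrable g volume 0 L := by
    rw [intervalIntegrable_iff_integrableOn_Ioo_of_le (hs.1.trans hs.2)]; exact hg
  refine this.mono_set ?_
  rw [uIcc_of_le (hs.1.trans hs.2)]
  exact uIcc_subset_Icc hs hx

theorem intervalIntegral_congr_ae_Ioo {F : Type*} [NormedAddCommGroup F] [NormedSpace ℝ F]
    {f g : ℝ → F} (h : f =ᵐ[intervalMeasure L] g)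
    {s x : ℝ} (hs : s ∈ Icc 0 L) (hx : x ∈ Icc 0 L) : ∫ t in s..x, f t = ∫ t in s..x, g t := by
  refine intervalIntegral.integral_congr_ae ?_
  have h' := (ae_restrict_iff' measurableSet_Ioo).1 h
  have h2 := (compl_mem_ae_iff (μ := (volume : Measure ℝ)) (s := {L})).2 (by simp)
  filter_upwards [h', h2] with t ht hne hm
  have := uIoc_subset_uIcc hm
  have hI := uIcc_subset_Icc hs hx this
  have : 0 < t := by
    rcases le_total s x with h | h
    · rw [uIoc_of_le h] at hm; exact hs.1.trans_lt hm.1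
    · rw [uIoc_of_ge h] at hm; exact hx.1.trans_lt hm.1
  exact ht ⟨this, lt_of_le_of_ne hI.2 hne⟩

theorem intervalIntegral_add_adjacent (g : L2 L) {s x : ℝ} (hs : s ∈ Icc 0 L) (hx : x ∈ Icc 0 L) :
    (∫ t in 0..s, g t) + ∫ t in s..x, g t = ∫ t in 0..x, g t := by
  have h0 : (0 : ℝ) ∈ Icc 0 L := ⟨le_rfl, hs.1.trans hs.2⟩
  exact intervalIntegral.integral_add_adjacent_intervals
    (intervalIntegrable_of_integrable (integrable_L2 g) h0 hs)
    (intervalIntegrable_of_integrable (integrable_L2 g) hs hx)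

/-- Primitives of `L²` functions are Hölder continuous with exponent `1/2`. -/
theorem norm_intervalIntegral_le (g : L2 L) {s x : ℝ} (hs : s ∈ Icc 0 L) (hx : x ∈ Icc 0 L) :
    ‖∫ t in s..x, g t‖ ≤ √|x - s| * ‖g‖ := by
  wlog h : s ≤ x generalizing s x
  · rw [intervalIntegral.integral_symm, norm_neg, abs_sub_comm]
    exact this hx hs (le_of_not_ge h)
  rw [intervalIntegral_eq_setIntegral_Ioo _ hs.1 h hx.2]
  refine (norm_setIntegral_le_sqrt_mul_norm g measurableSet_Ioo).trans ?_
  gcongr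
  rw [measureReal_def, Measure.restrict_apply measurableSet_Ioo,
    inter_eq_left.2 (Ioo_subset_Ioo hs.1 hx.2), Real.volume_Ioo,
    ENNReal.toReal_ofReal (sub_nonneg.2 h)]
  exact le_abs_self _

theorem continuousOn_primitive_L2 (g : L2 L) :
    ContinuousOn (fun x => ∫ t in 0..x, g t) (Icc 0 L) := by
  rcases lt_or_ge L 0 with hL | hL
  · simp [hL]
  have := intervalIntegral.continuousOn_primitive_interval (a := 0) (b := L) (f := g)
    (μ := volume) ?_
  · rwa [uIcc_of_le hL] at this
  · rw [uIcc_of_le hL, integrableOn_Icc_iff_integrableOn_Ioo]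
    exact integrable_L2 g

/-- Each function below the top one in a Sobolev function is a primitive of the next one. -/
theorem rep_eq_primitive (hL : 0 < L) {k : ℕ} (u : Sobolev L k) (j : Fin k) {x : ℝ}
    (hx : x ∈ Icc 0 L) :
    rep u j x = rep u j 0 + ∫ t in 0..x, weakD u j.succ t := by
  set v := weakD u j.succ with hv'
  have hv : Integrable v (intervalMeasure L) := integrable_L2 _
  have hu : Integrable (rep u j) (intervalMeasure L) :=
    (integrable_L2 (u.1 j.castSucc)).congr (weakD_ae_eq_rep u j)
  have h : HasWeakDeriv L (rep u j) v :=
    (u.2 j).congr_ae (weakD_ae_eq_rep u j).symm (EventuallyEq.refl _ _)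
  have hcont := continuousOn_primitive_L2 (u.1 j.succ)
  have hFi : Integrable (fun x => ∫ t in 0..x, v t) (intervalMeasure L) :=
    (hcont.integrableOn_compact isCompact_Icc).mono_set Ioo_subset_Icc_self
  have hF := hasWeakDeriv_primitive hL hv hFi
  have hw : HasWeakDeriv L (rep u j + (-1 : ℝ) • fun x => ∫ t in 0..x, v t) 0 := by
    refine (h.add (hF.const_smul (-1)) hu hv (hFi.smul _) (hv.smul _)).congr_ae
      (EventuallyEq.refl _ _) ?_
    filter_upwards with x
    simp
  obtain ⟨c, hc⟩ := ae_const_of_weakDeriv_zero hL (hu.add (hFi.smul _)) hw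
  have key : EqOn (rep u j) (fun x => c + ∫ t in 0..x, v t) (Icc 0 L) := by
    refine eqOn_Icc_of_ae_eq_Ioo hL (continuous_rep u j).continuousOn
      (continuousOn_const.add hcont) ?_
    filter_upwards [hc] with x hx
    rw [← hx]
    simp
  rw [key hx, key (left_mem_Icc.2 hL.le)]
  simp

theorem rep_sub_rep (hL : 0 < L) {k : ℕ} (u : Sobolev L k) (j : Fin k) {s x : ℝ} (hs : s ∈ Icc 0 L)
    (hx : x ∈ Icc 0 L) : rep u j x - rep u j s = ∫ t in s..x, weakD u j.succ t := by
  rw [rep_eq_primitive hL u j hx, rep_eq_primitive hL u j hs]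
  have := intervalIntegral_add_adjacent (u.1 j.succ) hs hx
  change (∫ t in 0..s, weakD u j.succ t) + ∫ t in s..x, weakD u j.succ t
    = ∫ t in 0..x, weakD u j.succ t at this
  rw [← this]; abel

theorem norm_component_le {k : ℕ} (u : Sobolev L k) (j : Fin (k + 1)) : ‖u.1 j‖ ≤ ‖u‖ :=
  PiLp.norm_apply_le u.1 j

theorem norm_rep_sub_rep_le (hL : 0 < L) {k : ℕ} (u : Sobolev L k) (j : Fin k) {s x : ℝ}
    (hs : s ∈ Icc 0 L) (hx : x ∈ Icc 0 L) : ‖rep u j x - rep u j s‖ ≤ √|x - s| * ‖u‖ := by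
  rw [rep_sub_rep hL u j hs hx]
  refine (norm_intervalIntegral_le (u.1 j.succ) hs hx).trans ?_
  gcongr
  exact norm_component_le _ _

theorem rep_add (hL : 0 < L) {k : ℕ} (u v : Sobolev L k) (j : Fin k) :
    EqOn (rep (u + v) j) (rep u j + rep v j) (Icc 0 L) := by
  refine eqOn_Icc_of_ae_eq_Ioo hL (continuous_rep _ _).continuousOn
    ((continuous_rep _ _).add (continuous_rep _ _)).continuousOn ?_
  have h := Lp.coeFn_add (u.1 j.castSucc) (v.1 j.castSucc)
  filter_upwards [weakD_ae_eq_rep (u + v) j, weakD_ae_eq_rep u j, weakD_ae_eq_rep v j, h]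
    with x h1 h2 h3 h4
  rw [Pi.add_apply, ← h1, ← h2, ← h3]
  exact h4

theorem rep_smul (hL : 0 < L) {k : ℕ} (c : ℝ) (u : Sobolev L k) (j : Fin k) :
    EqOn (rep (c • u) j) (c • rep u j) (Icc 0 L) := by
  refine eqOn_Icc_of_ae_eq_Ioo hL (continuous_rep _ _).continuousOn
    ((continuous_rep _ _).const_smul c).continuousOn ?_
  have h := Lp.coeFn_smul c (u.1 j.castSucc)
  filter_upwards [weakD_ae_eq_rep (c • u) j, weakD_ae_eq_rep u j, h] with x h1 h2 h4
  rw [Pi.smul_apply, ← h1, ← h2]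
  exact h4

/-- The embedding `Hᵏ⁺¹ ⊆ Cᵏ` on `[0, L]`, with an explicit constant. -/
theorem norm_rep_le (hL : 0 < L) {k : ℕ} (u : Sobolev L k) (j : Fin k) {x : ℝ} (hx : x ∈ Icc 0 L) :
    ‖rep u j x‖ ≤ (L⁻¹ * √L + √L) * ‖u‖ := by
  -- `L • rep u j x = ∫ rep u j + ∫ (rep u j x - rep u j t) dt`
  have hu : Integrable (rep u j) (intervalMeasure L) :=
    (integrable_L2 (u.1 j.castSucc)).congr (weakD_ae_eq_rep u j)
  have hμ : (intervalMeasure L).real univ = L := by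
    simp [measureReal_def, hL.le]
  have h1 : L • rep u j x = (∫ t, rep u j t ∂(intervalMeasure L)) +
      ∫ t, (rep u j x - rep u j t) ∂(intervalMeasure L) := by
    rw [integral_sub (integrable_const _) hu, integral_const, hμ]; abel
  have h2 : ‖∫ t, rep u j t ∂(intervalMeasure L)‖ ≤ √L * ‖u‖ := by
    rw [← integral_congr_ae (weakD_ae_eq_rep u j)]
    have := norm_setIntegral_le_sqrt_mul_norm (u.1 j.castSucc) MeasurableSet.univ
    rw [hμ, Measure.restrict_univ] at this
    exact this.trans (by gcongr; exact norm_component_le _ _)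
  have h3 : ‖∫ t, (rep u j x - rep u j t) ∂(intervalMeasure L)‖ ≤ (√L * ‖u‖) * L := by
    have := norm_integral_le_of_norm_le_const (μ := intervalMeasure L)
      (f := fun t => rep u j x - rep u j t) (C := √L * ‖u‖) ?_
    · rwa [hμ] at this
    · rw [ae_restrict_iff' measurableSet_Ioo]
      refine Eventually.of_forall fun t ht => ?_
      refine (norm_rep_sub_rep_le hL u j (Ioo_subset_Icc_self ht) hx).trans ?_
      gcongr
      rw [abs_le]; constructor <;> linarith [ht.1, ht.2, hx.1, hx.2]
  have h4 : L * ‖rep u j x‖ ≤ √L * ‖u‖ + (√L * ‖u‖) * L := by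
    have := norm_add_le_of_le h2 h3
    rwa [← h1, norm_smul, Real.norm_of_nonneg hL.le] at this
  have h5 : ‖rep u j x‖ = L⁻¹ * (L * ‖rep u j x‖) := by field_simp
  rw [h5]
  calc _ ≤ L⁻¹ * (√L * ‖u‖ + (√L * ‖u‖) * L) := by gcongr
    _ = _ := by field_simp

/-- Evaluation of the `j`-th derivative at a point of `[0, L]`, as a continuous linear map. -/
def evalCLM (hL : 0 < L) {k : ℕ} (j : Fin k) {x : ℝ} (hx : x ∈ Icc 0 L) : Sobolev L k →L[ℝ] E :=
  LinearMap.mkContinuous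
    { toFun := fun u => rep u j x
      map_add' := fun u v => rep_add hL u v j hx
      map_smul' := fun c u => rep_smul hL c u j hx } _ (fun u => norm_rep_le hL u j hx)

/-- The `j`-th weak derivative, as a continuous linear map into `L²`. -/
def componentCLM (L : ℝ) {k : ℕ} (j : Fin (k + 1)) : Sobolev L k →L[ℝ] L2 L :=
  (PiLp.proj 2 (fun _ : Fin (k + 1) => L2 L) j : _ →L[ℝ] L2 L).comp (Sobolev L k).subtypeL

/-! ### Weak convergence -/

/-- Weak convergence of a sequence in a normed space, tested against continuous functionals. -/
def WeakTendsto {X : Type*} [NormedAddCommGroup X] [NormedSpace ℝ X] (u : ℕ → X) (x : X) : Prop :=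
  ∀ f : X →L[ℝ] ℝ, Tendsto (fun n => f (u n)) atTop (𝓝 (f x))

section

variable {X Z : Type*} [NormedAddCommGroup X] [NormedSpace ℝ X] [NormedAddCommGroup Z]
  [NormedSpace ℝ Z] {u : ℕ → X} {x : X}

theorem weakTendsto_of_tendsto_weakSpace {u : ℕ → WeakSpace ℝ X} {x : WeakSpace ℝ X}
    (h : Tendsto u atTop (𝓝 x)) :
    WeakTendsto (fun n => (toWeakSpace ℝ X).symm (u n)) ((toWeakSpace ℝ X).symm x) := fun f =>
  ((WeakBilin.eval_continuous (topDualPairing ℝ X).flip f).tendsto x).comp h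

theorem WeakTendsto.map (h : WeakTendsto u x) (A : X →L[ℝ] Z) :
    WeakTendsto (fun n => A (u n)) (A x) := fun f => h (f.comp A)

theorem WeakTendsto.comp (h : WeakTendsto u x) {φ : ℕ → ℕ} (hφ : StrictMono φ) :
    WeakTendsto (u ∘ φ) x := fun f => (h f).comp hφ.tendsto_atTop

theorem weakTendsto_of_tendsto (h : Tendsto u atTop (𝓝 x)) : WeakTendsto u x := fun f =>
  (f.continuous.tendsto x).comp h

/-- Weakly convergent sequences are bounded, by the uniform boundedness principle in the dual. -/
theorem WeakTendsto.bounded (h : WeakTendsto u x) : ∃ C, 0 ≤ C ∧ ∀ n, ‖u n‖ ≤ C := by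
  obtain ⟨C, hC⟩ := banach_steinhaus (E := StrongDual ℝ X) (F := ℝ) (𝕜 := ℝ) (𝕜₂ := ℝ)
    (g := fun n => NormedSpace.inclusionInDoubleDual ℝ X (u n)) (fun f => by
      obtain ⟨C, hC⟩ := (Metric.isBounded_range_of_tendsto _ (h f)).exists_norm_le
      exact ⟨C, fun i => hC _ ⟨i, rfl⟩⟩)
  have hC' : ∀ n, ‖u n‖ ≤ C := fun n => by
    rw [← (NormedSpace.inclusionInDoubleDualLi ℝ (E := X)).norm_map (u n)]
    exact hC n
  exact ⟨C, (norm_nonneg _).trans (hC' 0), hC'⟩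

/-- In finite dimension, weak convergence is convergence. -/
theorem WeakTendsto.tendsto_of_finiteDimensional [FiniteDimensional ℝ Z] {u : ℕ → Z} {x : Z}
    (h : WeakTendsto u x) : Tendsto u atTop (𝓝 x) := by
  let e := ContinuousLinearEquiv.ofFinrankEq (𝕜 := ℝ) (E := Z)
    (F := Fin (Module.finrank ℝ Z) → ℝ) (by simp)
  have : Tendsto (fun n => e (u n)) atTop (𝓝 (e x)) := by
    rw [tendsto_pi_nhds]
    intro i
    exact h ((ContinuousLinearMap.proj (R := ℝ) (φ := fun _ => ℝ) i).comp (e : Z →L[ℝ] _))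
  have h2 := (e.symm.continuous.tendsto (e x)).comp this
  simpa [Function.comp_def] using h2

end

/-- Weak convergence in `Hᵏ` forces uniform convergence of the derivatives of order below `k`:
pointwise convergence is upgraded by equicontinuity. -/
theorem tendstoUniformlyOn_rep (hL : 0 < L) {k : ℕ} {u : ℕ → Sobolev L k} {v : Sobolev L k}
    (h : WeakTendsto u v) (j : Fin k) :
    TendstoUniformlyOn (fun n => rep (u n) j) (rep v j) atTop (Icc 0 L) := by
  obtain ⟨C, hC0, hC⟩ := h.bounded
  rw [← tendstoLocallyUniformlyOn_iff_tendstoUniformlyOn_of_compact isCompact_Icc,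
    Metric.tendstoLocallyUniformlyOn_iff]
  intro δ hδ x hx
  have hc : Tendsto (fun s => √|s - x| * (C + ‖v‖)) (𝓝 x) (𝓝 (√|x - x| * (C + ‖v‖))) :=
    Continuous.tendsto (by fun_prop) x
  rw [sub_self, abs_zero, Real.sqrt_zero, zero_mul] at hc
  have hev := hc.eventually_lt_const (half_pos hδ)
  refine ⟨{s | √|s - x| * (C + ‖v‖) < δ / 2} ∩ Icc 0 L, inter_mem (mem_nhdsWithin_of_mem_nhds hev)
    self_mem_nhdsWithin, ?_⟩
  have hpt : Tendsto (fun n => rep (u n) j x) atTop (𝓝 (rep v j x)) :=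
    (h.map (evalCLM hL j hx)).tendsto_of_finiteDimensional
  filter_upwards [Metric.tendsto_nhds.1 hpt (δ / 2) (half_pos hδ)] with n hn s hs
  have h1 := norm_rep_sub_rep_le hL (u n) j hx hs.2
  have h2 := norm_rep_sub_rep_le hL v j hx hs.2
  have h3 : √|s - x| * ‖u n‖ ≤ √|s - x| * C := by gcongr; exact hC n
  have h4 : √|s - x| * (C + ‖v‖) < δ / 2 := hs.1
  rw [dist_eq_norm] at hn
  rw [dist_comm, dist_eq_norm]
  have e : rep (u n) j s - rep v j s = (rep (u n) j s - rep (u n) j x) +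
    (rep (u n) j x - rep v j x) - (rep v j s - rep v j x) := by abel
  rw [e]
  refine (norm_sub_le_of_le (norm_add_le_of_le h1 hn.le) h2).trans_lt ?_
  nlinarith

/-! ### Pairing weakly and strongly convergent sequences -/

section

variable {H K : Type*} [NormedAddCommGroup H] [InnerProductSpace ℝ H] [NormedAddCommGroup K]
  [InnerProductSpace ℝ K] {v : ℕ → H} {w : H}

theorem tendsto_clm_apply {S : ℕ → H →L[ℝ] K} {T : H →L[ℝ] K} (hS : Tendsto S atTop (𝓝 T))
    {g : ℕ → H} {g₀ : H} (hg : Tendsto g atTop (𝓝 g₀)) :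
    Tendsto (fun n => S n (g n)) atTop (𝓝 (T g₀)) :=
  (isBoundedBilinearMap_apply.continuous.tendsto (T, g₀)).comp (hS.prodMk_nhds hg)

/-- The inner product of a strongly and a weakly convergent sequence converges. -/
theorem WeakTendsto.inner_tendsto (hv : WeakTendsto v w) {g : ℕ → H} {g₀ : H}
    (hg : Tendsto g atTop (𝓝 g₀)) :
    Tendsto (fun n => inner ℝ (g n) (v n)) atTop (𝓝 (inner ℝ g₀ w)) := by
  obtain ⟨C, -, hC⟩ := hv.bounded
  have h1 : Tendsto (fun n => inner ℝ g₀ (v n)) atTop (𝓝 (inner ℝ g₀ w)) := hv (innerSL ℝ g₀)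
  have h2 : Tendsto (fun n => inner ℝ (g n - g₀) (v n)) atTop (𝓝 0) := by
    have h3 : Tendsto (fun n => ‖g n - g₀‖ * C) atTop (𝓝 0) := by
      simpa using (tendsto_iff_norm_sub_tendsto_zero.1 hg).mul_const C
    refine squeeze_zero_norm (fun n => ?_) h3
    exact (norm_inner_le_norm _ _).trans (by gcongr; exact hC n)
  simpa [inner_sub_left] using h2.add h1

variable [CompleteSpace H] [CompleteSpace K]

/-- The polarized form of `‖S v‖²`; since `S n` converges in norm, so does its adjoint, which leaves
a weak-strong pairing `⟪(S n)† (S n) w, v n⟫`. -/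
theorem WeakTendsto.inner_map_tendsto (hv : WeakTendsto v w) {S : ℕ → H →L[ℝ] K} {T : H →L[ℝ] K}
    (hS : Tendsto S atTop (𝓝 T)) :
    Tendsto (fun n => inner ℝ (S n w) (S n (v n))) atTop (𝓝 (‖T w‖ ^ 2)) := by
  have h1 : Tendsto (fun n => (S n).adjoint (S n w)) atTop (𝓝 (T.adjoint (T w))) := by
    have ha : Tendsto (fun n => (S n).adjoint) atTop (𝓝 T.adjoint) :=
      ((ContinuousLinearMap.adjoint (𝕜 := ℝ) (E := H) (F := K)).continuous.tendsto T).comp hS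
    exact tendsto_clm_apply ha (tendsto_clm_apply hS tendsto_const_nhds)
  have h2 := hv.inner_tendsto h1
  simpa [ContinuousLinearMap.adjoint_inner_left] using h2

/-- Weak lower semicontinuity of `a ‖v‖² - c ‖S v‖²`, a convex quadratic form since `‖S‖ ≤ 1` and
`c ≤ a`, under norm convergence of the operators: the lower bound `e` converges to the value of the
form at the limit. -/
theorem WeakTendsto.exists_lower_bound_sub (hv : WeakTendsto v w) {S : ℕ → H →L[ℝ] K}
    {T : H →L[ℝ] K} (hS : Tendsto S atTop (𝓝 T)) (hS1 : ∀ n, ‖S n‖ ≤ 1) {a c : ℝ} (hc : 0 ≤ c)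
    (hca : c ≤ a) : ∃ e : ℕ → ℝ, (∀ n, e n ≤ a * ‖v n‖ ^ 2 - c * ‖S n (v n)‖ ^ 2) ∧
      Tendsto e atTop (𝓝 (a * ‖w‖ ^ 2 - c * ‖T w‖ ^ 2)) := by
  refine ⟨fun n => a * (2 * inner ℝ w (v n) - ‖w‖ ^ 2)
    - c * (2 * inner ℝ (S n w) (S n (v n)) - ‖S n w‖ ^ 2), fun n => ?_, ?_⟩
  · have h1 : ‖v n - w‖ ^ 2 = ‖v n‖ ^ 2 - (2 * inner ℝ w (v n) - ‖w‖ ^ 2) := by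
      rw [norm_sub_sq_real, real_inner_comm]; ring
    have h2 : ‖S n (v n - w)‖ ^ 2 = ‖S n (v n)‖ ^ 2 -
        (2 * inner ℝ (S n w) (S n (v n)) - ‖S n w‖ ^ 2) := by
      rw [map_sub, norm_sub_sq_real, real_inner_comm]; ring
    have h3 : ‖S n (v n - w)‖ ≤ ‖v n - w‖ := by
      simpa using (S n).le_of_opNorm_le (hS1 n) (v n - w)
    have h4 : ‖S n (v n - w)‖ ^ 2 ≤ ‖v n - w‖ ^ 2 := by gcongr
    nlinarith [mul_le_mul hca h4 (sq_nonneg _) (hc.trans hca)]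
  · have h1 : Tendsto (fun n => inner ℝ w (v n)) atTop (𝓝 (inner ℝ w w)) :=
      hv.inner_tendsto tendsto_const_nhds
    have h2 := hv.inner_map_tendsto hS
    have h3 : Tendsto (fun n => ‖S n w‖ ^ 2) atTop (𝓝 (‖T w‖ ^ 2)) :=
      (tendsto_clm_apply hS tendsto_const_nhds).norm.pow 2
    rw [real_inner_self_eq_norm_sq] at h1
    have := (((h1.const_mul 2).sub_const (‖w‖ ^ 2)).const_mul a).sub
      (((h2.const_mul 2).sub h3).const_mul c)
    convert this using 2
    ring

/-- Weak lower semicontinuity of `‖S v‖²` under norm convergence of the operators. -/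
theorem WeakTendsto.exists_lower_bound_map (hv : WeakTendsto v w) {S : ℕ → H →L[ℝ] K}
    {T : H →L[ℝ] K} (hS : Tendsto S atTop (𝓝 T)) :
    ∃ e : ℕ → ℝ, (∀ n, e n ≤ ‖S n (v n)‖ ^ 2) ∧ Tendsto e atTop (𝓝 (‖T w‖ ^ 2)) := by
  refine ⟨fun n => 2 * inner ℝ (S n w) (S n (v n)) - ‖S n w‖ ^ 2, fun n => ?_, ?_⟩
  · have h := sq_nonneg ‖S n (v n) - S n w‖
    rw [norm_sub_sq_real, real_inner_comm] at h
    linarith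
  · have h2 := hv.inner_map_tendsto hS
    have h3 : Tendsto (fun n => ‖S n w‖ ^ 2) atTop (𝓝 (‖T w‖ ^ 2)) :=
      (tendsto_clm_apply hS tendsto_const_nhds).norm.pow 2
    have := (h2.const_mul 2).sub h3
    convert this using 2
    ring

end

/-! ### Pointwise inner products with a bounded field -/

theorem memLp_inner {β : ℝ → E} (hβ : Measurable β) {C : ℝ} (hC : ∀ x ∈ Ioo 0 L, ‖β x‖ ≤ C)
    (v : L2 L) :
    MemLp (fun x => inner ℝ (β x) (v x)) 2 (intervalMeasure L) := by
  refine (Lp.memLp v).of_le_mul (c := C)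
    (hβ.aestronglyMeasurable.inner (Lp.aestronglyMeasurable v)) ?_
  rw [ae_restrict_iff' measurableSet_Ioo]
  refine Eventually.of_forall fun x hx => (norm_inner_le_norm _ _).trans ?_
  gcongr
  exact hC x hx

/-- The map `v ↦ β · v` from `L²((0, L); ℝ³)` to `L²((0, L))`, for a bounded measurable `β`. -/
def innerMul (β : ℝ → E) (hβ : Measurable β) (C : ℝ) (hC : ∀ x ∈ Ioo 0 L, ‖β x‖ ≤ C) :
    L2 L →L[ℝ] Lp ℝ 2 (intervalMeasure L) :=
  LinearMap.mkContinuous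
    { toFun := fun v => (memLp_inner hβ hC v).toLp
      map_add' := fun u v => by
        rw [← MemLp.toLp_add]
        refine MemLp.toLp_congr _ _ ?_
        filter_upwards [Lp.coeFn_add u v] with x hx
        rw [hx, Pi.add_apply, inner_add_right, Pi.add_apply]
      map_smul' := fun c u => by
        rw [RingHom.id_apply, ← MemLp.toLp_const_smul]
        refine MemLp.toLp_congr _ _ ?_
        filter_upwards [Lp.coeFn_smul c u] with x hx
        rw [hx, Pi.smul_apply, inner_smul_right, Pi.smul_apply, smul_eq_mul] } C (fun v => by
      refine Lp.norm_le_mul_norm_of_ae_le_mul ?_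
      filter_upwards [(memLp_inner hβ hC v).coeFn_toLp, ae_restrict_mem measurableSet_Ioo]
        with x hx hx'
      refine (congrArg norm hx).le.trans ((norm_inner_le_norm _ _).trans ?_)
      gcongr
      exact hC x hx')

theorem coeFn_innerMul {β : ℝ → E} (hβ : Measurable β) {C : ℝ} (hC : ∀ x ∈ Ioo 0 L, ‖β x‖ ≤ C)
    (v : L2 L) :
    innerMul β hβ C hC v =ᵐ[intervalMeasure L] fun x => inner ℝ (β x) (v x) :=
  (memLp_inner hβ hC v).coeFn_toLp

theorem norm_innerMul_sub_le {β γ : ℝ → E} (hβ : Measurable β) {C : ℝ}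
    (hC : ∀ x ∈ Ioo 0 L, ‖β x‖ ≤ C) (hγ : Measurable γ) {D : ℝ} (hD : ∀ x ∈ Ioo 0 L, ‖γ x‖ ≤ D)
    {δ : ℝ} (hδ : 0 ≤ δ) (h : ∀ᵐ x ∂(intervalMeasure L), ‖β x - γ x‖ ≤ δ) :
    ‖innerMul β hβ C hC - innerMul γ hγ D hD‖ ≤ δ := by
  refine ContinuousLinearMap.opNorm_le_bound _ hδ fun v => ?_
  refine Lp.norm_le_mul_norm_of_ae_le_mul ?_
  rw [sub_apply]
  filter_upwards [Lp.coeFn_sub (innerMul β hβ C hC v) (innerMul γ hγ D hD v),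
    coeFn_innerMul hβ hC v, coeFn_innerMul hγ hD v, h]
    with x h1 h2 h3 h4
  rw [h1, Pi.sub_apply, h2, h3, ← inner_sub_left]
  exact (norm_inner_le_norm _ _).trans (by gcongr)

theorem norm_innerMul_le {β : ℝ → E} (hβ : Measurable β) {C : ℝ} (hC0 : 0 ≤ C)
    (hC : ∀ x ∈ Ioo 0 L, ‖β x‖ ≤ C) : ‖innerMul β hβ C hC‖ ≤ C :=
  LinearMap.mkContinuous_norm_le _ hC0 _

/-- Uniform convergence (up to null sets) of the fields gives norm convergence of the operators.
Null sets have to be allowed because elementwise averages vanish at the nodes. -/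
theorem tendsto_innerMul {β : ℕ → ℝ → E} (hβ : ∀ n, Measurable (β n)) {C : ℕ → ℝ}
    (hC : ∀ n, ∀ x ∈ Ioo 0 L, ‖β n x‖ ≤ C n) {γ : ℝ → E} (hγ : Measurable γ) {D : ℝ}
    (hD : ∀ x ∈ Ioo 0 L, ‖γ x‖ ≤ D)
    (h : ∀ δ > 0, ∀ᶠ n in atTop, ∀ᵐ x ∂(intervalMeasure L), ‖β n x - γ x‖ ≤ δ) :
    Tendsto (fun n => innerMul (β n) (hβ n) (C n) (hC n)) atTop (𝓝 (innerMul γ hγ D hD)) := by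
  rw [Metric.tendsto_nhds]
  intro δ hδ
  filter_upwards [h (δ / 2) (half_pos hδ)] with n hn
  rw [dist_eq_norm]
  exact (norm_innerMul_sub_le (hβ n) (hC n) hγ hD (half_pos hδ).le hn).trans_lt
    (half_lt_self hδ)

theorem integral_norm_sq_eq {F : Type*} [NormedAddCommGroup F] [InnerProductSpace ℝ F]
    {μ : Measure ℝ} (v : Lp F 2 μ) : ∫ x, ‖v x‖ ^ 2 ∂μ = ‖v‖ ^ 2 := by
  rw [← real_inner_self_eq_norm_sq, L2.inner_def]
  simp only [real_inner_self_eq_norm_sq]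

theorem integral_inner_sq_eq {β : ℝ → E} (hβ : Measurable β) {C : ℝ} (hC : ∀ x ∈ Ioo 0 L, ‖β x‖ ≤ C)
    (v : L2 L) :
    ∫ x in Ioo 0 L, inner ℝ (β x) (v x) ^ 2 = ‖innerMul β hβ C hC v‖ ^ 2 := by
  rw [← integral_norm_sq_eq]
  refine integral_congr_ae ?_
  filter_upwards [coeFn_innerMul hβ hC v] with x hx
  simp [hx]

/-! ### The cross product -/

theorem inner_eq_sum (u v : E) : inner ℝ u v = u 0 * v 0 + u 1 * v 1 + u 2 * v 2 := by
  simp [PiLp.inner_apply, Fin.sum_univ_three, mul_comm]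

theorem cross_apply_zero (u v : E) : cross u v 0 = u 1 * v 2 - u 2 * v 1 := by
  simp [cross, cross_apply]

theorem cross_apply_one (u v : E) : cross u v 1 = u 2 * v 0 - u 0 * v 2 := by
  simp [cross, cross_apply]

theorem cross_apply_two (u v : E) : cross u v 2 = u 0 * v 1 - u 1 * v 0 := by
  simp [cross, cross_apply]

theorem norm_cross_le (u v : E) : ‖cross u v‖ ≤ ‖u‖ * ‖v‖ := by
  refine le_of_sq_le_sq ?_ (by positivity)
  have h : ‖cross u v‖ ^ 2 = ‖u‖ ^ 2 * ‖v‖ ^ 2 - inner ℝ u v ^ 2 := by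
    simp only [← real_inner_self_eq_norm_sq, inner_eq_sum, cross_apply_zero, cross_apply_one,
      cross_apply_two]
    ring
  nlinarith [sq_nonneg (inner ℝ u v)]

theorem cross_sub_cross (u v u' v' : E) :
    cross u v - cross u' v' = cross (u - u') v + cross u' (v - v') := by
  ext i
  fin_cases i <;>
    simp [cross_apply_zero, cross_apply_one, cross_apply_two] <;> ring

theorem continuous_cross : Continuous fun p : E × E => cross p.1 p.2 := by
  refine (PiLp.continuous_toLp 2 _).comp (continuous_pi fun i => ?_)
  fin_cases i <;> simp [cross_apply] <;> fun_prop

/-- Parseval in the orthonormal frame `t`, `b`, `t × b`. -/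
theorem norm_sq_eq_frame {t b : E} (ht : ‖t‖ = 1) (hb : ‖b‖ = 1) (htb : inner ℝ t b = 0) (w : E) :
    ‖w‖ ^ 2 = inner ℝ t w ^ 2 + inner ℝ b w ^ 2 + inner ℝ w (cross t b) ^ 2 := by
  -- the square of `det (w, t, b)` is the Gram determinant of `w`, `t`, `b`
  have gram : inner ℝ w (cross t b) ^ 2 = ‖w‖ ^ 2 * (‖t‖ ^ 2 * ‖b‖ ^ 2 - inner ℝ t b ^ 2)
      - inner ℝ t w * (inner ℝ t w * ‖b‖ ^ 2 - inner ℝ t b * inner ℝ b w)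
      + inner ℝ b w * (inner ℝ t w * inner ℝ t b - ‖t‖ ^ 2 * inner ℝ b w) := by
    simp only [← real_inner_self_eq_norm_sq, inner_eq_sum, cross_apply_zero, cross_apply_one,
      cross_apply_two]
    ring
  rw [gram, ht, hb, htb]
  ring

/-! ### Partitions, nodal interpolation and elementwise averages -/

namespace Partition

variable (P : Partition L)

theorem left_lt_right (i : Fin P.N) : P.left i < P.right i :=
  P.strictMono i.castSucc_lt_succ

theorem node_mem (j : Fin (P.N + 1)) : P.node j ∈ Icc 0 L := by
  constructor
  · rw [← P.node_zero]; exact P.strictMono.monotone (Fin.zero_le j)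
  · exact (P.strictMono.monotone (Fin.le_last j)).trans_eq P.node_last

theorem left_mem (i : Fin P.N) : P.left i ∈ Icc 0 L := P.node_mem _

theorem right_mem (i : Fin P.N) : P.right i ∈ Icc 0 L := P.node_mem _

theorem element_subset (i : Fin P.N) : Icc (P.left i) (P.right i) ⊆ Icc 0 L :=
  Icc_subset_Icc (P.left_mem i).1 (P.right_mem i).2

theorem length_le_mesh (i : Fin P.N) : P.right i - P.left i ≤ P.mesh :=
  le_ciSup (f := fun i : Fin P.N => P.right i - P.left i) (finite_range _).bddAbove i

theorem exists_Ioc (P : Partition L) {x : ℝ} (hx : x ∈ Ioc 0 L) :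
    ∃ i : Fin P.N, x ∈ Ioc (P.left i) (P.right i) := by
  by_contra! h
  have key : ∀ j : Fin (P.N + 1), P.node j < x := by
    intro j
    induction j using Fin.induction with
    | zero => rw [P.node_zero]; exact hx.1
    | succ i ih =>
      by_contra! h'
      exact h i ⟨ih, h'⟩
  have := key (Fin.last _)
  rw [P.node_last] at this
  exact this.not_ge hx.2

theorem exists_node_near (P : Partition L) {x : ℝ} (hx : x ∈ Icc 0 L) :
    ∃ j, |P.node j - x| ≤ P.mesh := by
  rcases eq_or_lt_of_le hx.1 with h | h
  · refine ⟨0, ?_⟩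
    rw [P.node_zero, ← h]
    simp only [sub_self, abs_zero]
    exact Real.iSup_nonneg fun i => sub_nonneg.2 (P.left_lt_right i).le
  · obtain ⟨i, hi⟩ := P.exists_Ioc ⟨h, hx.2⟩
    refine ⟨i.succ, ?_⟩
    have h1 := P.length_le_mesh i
    have h2 := hi.1
    have h3 : x ≤ P.node i.succ := hi.2
    change P.node i.succ - P.left i ≤ P.mesh at h1
    rw [abs_of_nonneg (by linarith)]
    linarith

theorem ae_mem_element (P : Partition L) :
    ∀ᵐ x ∂(intervalMeasure L), ∃ i, x ∈ Ioo (P.left i) (P.right i) := by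
  rw [ae_restrict_iff' measurableSet_Ioo]
  have := (compl_mem_ae_iff (μ := (volume : Measure ℝ)) (s := range P.node)).2
    ((finite_range _).measure_zero _)
  filter_upwards [this] with x hx hx'
  obtain ⟨i, hi⟩ := P.exists_Ioc (Ioo_subset_Ioc_self hx')
  exact ⟨i, hi.1, lt_of_le_of_ne hi.2 fun h => hx ⟨i.succ, h.symm⟩⟩

theorem element_unique {i j : Fin P.N} {x : ℝ} (hi : x ∈ Ioo (P.left i) (P.right i))
    (hj : x ∈ Ioo (P.left j) (P.right j)) : i = j := by
  by_contra h
  wlog hij : i < j generalizing i j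
  · exact this hj hi (Ne.symm h) (lt_of_le_of_ne (not_lt.1 hij) (Ne.symm h))
  have : P.right i ≤ P.left j := P.strictMono.monotone (by
    rw [Fin.le_def, Fin.val_succ, Fin.val_castSucc]; exact hij)
  exact (hi.2.trans_le this).not_gt hj.1

theorem sum_indicator_of_mem {F : Type*} [AddCommMonoid F] (f : Fin P.N → ℝ → F) {i : Fin P.N}
    {x : ℝ} (hx : x ∈ Ioo (P.left i) (P.right i)) :
    ∑ j, (Ioo (P.left j) (P.right j)).indicator (f j) x = f i x := by
  rw [Finset.sum_eq_single i, indicator_of_mem hx]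
  · intro j _ hj
    exact indicator_of_notMem (fun h => hj (P.element_unique h hx)) _
  · simp

theorem avg_of_mem (v : ℝ → E) {i : Fin P.N} {x : ℝ} (hx : x ∈ Ioo (P.left i) (P.right i)) :
    P.avg v x = (P.right i - P.left i)⁻¹ • ∫ ξ in (P.left i)..(P.right i), v ξ :=
  P.sum_indicator_of_mem _ hx

theorem measurable_avg (v : ℝ → E) : Measurable (P.avg v) :=
  Finset.measurable_fun_sum _ fun _ _ => measurable_const.indicator measurableSet_Ioo

/-- If `v` is within `δ` of `c` on an element, then so is its mean value over that element. -/
theorem norm_mean_sub_le {v : ℝ → E} (hv : Continuous v) {i : Fin P.N} {c : E} {δ : ℝ}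
    (h : ∀ t ∈ Icc (P.left i) (P.right i), ‖v t - c‖ ≤ δ) :
    ‖((P.right i - P.left i)⁻¹ • ∫ ξ in (P.left i)..(P.right i), v ξ) - c‖ ≤ δ := by
  have hlt := P.left_lt_right i
  have hpos : 0 < P.right i - P.left i := sub_pos.2 hlt
  have e : ((P.right i - P.left i)⁻¹ • ∫ ξ in (P.left i)..(P.right i), v ξ) - c
      = (P.right i - P.left i)⁻¹ • ∫ ξ in (P.left i)..(P.right i), (v ξ - c) := by
    rw [intervalIntegral.integral_sub (hv.intervalIntegrable _ _) (by simp),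
      intervalIntegral.integral_const, smul_sub, smul_smul, inv_mul_cancel₀ hpos.ne', one_smul]
  rw [e, norm_smul, norm_inv, Real.norm_of_nonneg hpos.le]
  have := intervalIntegral.norm_integral_le_of_norm_le_const (a := P.left i) (b := P.right i)
    (f := fun ξ => v ξ - c) (C := δ) fun t ht => h t (by
      rw [uIoc_of_le hlt.le] at ht; exact Ioc_subset_Icc_self ht)
  rw [abs_of_pos hpos] at this
  rw [inv_mul_le_iff₀ hpos]
  linarith

theorem norm_avg_le {v : ℝ → E} (hv : Continuous v) {C : ℝ} (hC : 0 ≤ C)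
    (h : ∀ t ∈ Icc 0 L, ‖v t‖ ≤ C) (x : ℝ) : ‖P.avg v x‖ ≤ C := by
  by_cases hx : ∃ i, x ∈ Ioo (P.left i) (P.right i)
  · obtain ⟨i, hi⟩ := hx
    rw [P.avg_of_mem v hi]
    simpa using P.norm_mean_sub_le hv (c := 0) (δ := C) (i := i) fun t ht => by
      simpa using h t (P.element_subset i ht)
  · have : P.avg v x = 0 := Finset.sum_eq_zero fun i _ =>
      indicator_of_notMem (fun h => hx ⟨i, h⟩) _
    rw [this, norm_zero]; exact hC

theorem hat_of_mem (j : Fin (P.N + 1)) {i : Fin P.N} {x : ℝ}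
    (hx : x ∈ Ioo (P.left i) (P.right i)) :
    P.hat j x = if j = i.castSucc then (P.right i - x) / (P.right i - P.left i)
      else if j = i.succ then (x - P.left i) / (P.right i - P.left i) else 0 := by
  have hne : x ≠ P.node j := by
    rintro rfl
    have h1 := P.strictMono.lt_iff_lt.1 hx.1
    have h2 := P.strictMono.lt_iff_lt.1 hx.2
    rw [Fin.lt_def, Fin.val_castSucc] at h1
    rw [Fin.lt_def, Fin.val_succ] at h2
    omega
  rw [hat, if_neg hne, P.sum_indicator_of_mem _ hx]

theorem interp_of_mem (f : ℝ → ℝ) {i : Fin P.N} {x : ℝ} (hx : x ∈ Ioo (P.left i) (P.right i)) :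
    P.interp f x = f (P.left i) * ((P.right i - x) / (P.right i - P.left i))
      + f (P.right i) * ((x - P.left i) / (P.right i - P.left i)) := by
  have hne : i.castSucc ≠ i.succ := i.castSucc_lt_succ.ne
  rw [interp, ← Finset.add_sum_erase _ _ (Finset.mem_univ i.castSucc),
    ← Finset.add_sum_erase _ _ (Finset.mem_erase.2 ⟨hne.symm, Finset.mem_univ i.succ⟩),
    Finset.sum_eq_zero, P.hat_of_mem _ hx, P.hat_of_mem _ hx, if_pos rfl, if_neg hne.symm,
    if_pos rfl, add_zero]
  · rfl
  · intro j hj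
    simp only [Finset.mem_erase, Finset.mem_univ, and_true] at hj
    rw [P.hat_of_mem _ hx, if_neg hj.2, if_neg hj.1, mul_zero]

theorem measurable_interp (f : ℝ → ℝ) : Measurable (P.interp f) := by
  refine Finset.measurable_fun_sum _ fun j _ => Measurable.const_mul ?_ _
  refine Measurable.ite (measurableSet_singleton _) measurable_const ?_
  refine Finset.measurable_fun_sum _ fun i _ => Measurable.indicator ?_ measurableSet_Ioo
  split_ifs <;> fun_prop

theorem abs_interp_sub_le (f : ℝ → ℝ) {i : Fin P.N} {x c δ : ℝ}
    (hx : x ∈ Ioo (P.left i) (P.right i)) (hl : |f (P.left i) - c| ≤ δ)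
    (hr : |f (P.right i) - c| ≤ δ) : |P.interp f x - c| ≤ δ := by
  have hpos : 0 < P.right i - P.left i := sub_pos.2 (P.left_lt_right i)
  rw [P.interp_of_mem f hx]
  set s := (P.right i - x) / (P.right i - P.left i) with hs
  set t := (x - P.left i) / (P.right i - P.left i) with ht
  have hst : s + t = 1 := by rw [hs, ht]; field_simp; ring
  have hs0 : 0 ≤ s := div_nonneg (sub_nonneg.2 hx.2.le) hpos.le
  have ht0 : 0 ≤ t := div_nonneg (sub_nonneg.2 hx.1.le) hpos.le
  rw [abs_le] at *
  have e : f (P.left i) * s + f (P.right i) * t - c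
    = (f (P.left i) - c) * s + (f (P.right i) - c) * t := by linear_combination c * hst
  rw [e]
  constructor <;> nlinarith

theorem interp_nonneg {f : ℝ → ℝ} (hf : ∀ x, 0 ≤ f x) {x : ℝ}
    (hx : ∃ i, x ∈ Ioo (P.left i) (P.right i)) : 0 ≤ P.interp f x := by
  obtain ⟨i, hi⟩ := hx
  have hpos : 0 < P.right i - P.left i := sub_pos.2 (P.left_lt_right i)
  rw [P.interp_of_mem f hi]
  exact add_nonneg (mul_nonneg (hf _) (div_nonneg (sub_nonneg.2 hi.2.le) hpos.le))
    (mul_nonneg (hf _) (div_nonneg (sub_nonneg.2 hi.1.le) hpos.le))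

theorem integral_interp_nonneg {f : ℝ → ℝ} (hf : ∀ x, 0 ≤ f x) :
    0 ≤ ∫ x in Ioo 0 L, P.interp f x :=
  integral_nonneg_of_ae (P.ae_mem_element.mono fun _ hx => P.interp_nonneg hf hx)

theorem interp_eq_zero {f : ℝ → ℝ} (hf : ∀ j, f (P.node j) = 0) : P.interp f = 0 :=
  funext fun x => Finset.sum_eq_zero fun j _ => by rw [hf j, zero_mul]

/-- An elementwise affine function is bounded by the maximum of its nodal values. -/
theorem norm_le_of_isPiecewisePoly_one {f : ℝ → E} (hf : P.IsPiecewisePoly 1 f) {C : ℝ}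
    (h : ∀ j, ‖f (P.node j)‖ ≤ C) {x : ℝ} (hx : x ∈ Icc 0 L) : ‖f x‖ ≤ C := by
  rcases eq_or_lt_of_le hx.1 with h0 | h0
  · have := h 0
    rwa [P.node_zero, h0] at this
  obtain ⟨i, hi⟩ := P.exists_Ioc ⟨h0, hx.2⟩
  obtain ⟨c, hc⟩ := hf i
  have hlt := P.left_lt_right i
  have hl := h i.castSucc
  have hr := h i.succ
  change ‖f (P.left i)‖ ≤ C at hl
  change ‖f (P.right i)‖ ≤ C at hr
  rw [hc _ (left_mem_Icc.2 hlt.le)] at hl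
  rw [hc _ (right_mem_Icc.2 hlt.le)] at hr
  rw [hc _ (Ioc_subset_Icc_self hi)]
  have aff : ∀ z : ℝ, ∑ k : Fin (1 + 1), z ^ (k : ℕ) • c k = c 0 + z • c 1 := fun z => by
    rw [Fin.sum_univ_two]; simp
  rw [aff] at hl hr ⊢
  have hpos : 0 < P.right i - P.left i := sub_pos.2 hlt
  set s := (P.right i - x) / (P.right i - P.left i) with hs
  set t := (x - P.left i) / (P.right i - P.left i) with ht
  have hst : s + t = 1 := by rw [hs, ht]; field_simp; ring
  have hx' : x = s * P.left i + t * P.right i := by rw [hs, ht]; field_simp; ring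
  have hs0 : 0 ≤ s := div_nonneg (sub_nonneg.2 hi.2) hpos.le
  have ht0 : 0 ≤ t := div_nonneg (sub_nonneg.2 hi.1.le) hpos.le
  have e : c 0 + x • c 1 = s • (c 0 + P.left i • c 1) + t • (c 0 + P.right i • c 1) := by
    rw [hx']
    have : c 0 = (s + t) • c 0 := by rw [hst, one_smul]
    nth_rewrite 1 [this]
    module
  rw [e]
  refine (norm_add_le _ _).trans ?_
  rw [norm_smul, norm_smul, Real.norm_of_nonneg hs0, Real.norm_of_nonneg ht0]
  have hC : C = s * C + t * C := by rw [← add_mul, hst, one_mul]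
  rw [hC]
  gcongr

end Partition

/-! ### Uniform limits on partitions of vanishing mesh size -/

/-- Uniform convergence may be evaluated at points shifted by at most the mesh size. -/
theorem eventually_dist_lt_of_mesh {P : ℕ → Partition L}
    (hP : Tendsto (fun n => (P n).mesh) atTop (𝓝 0))
    {F : Type*} [PseudoMetricSpace F] {f : ℕ → ℝ → F} {g : ℝ → F}
    (hfg : TendstoUniformlyOn f g atTop (Icc 0 L)) (hg : ContinuousOn g (Icc 0 L)) {δ : ℝ}
    (hδ : 0 < δ) : ∀ᶠ n in atTop, ∀ x ∈ Icc 0 L, ∀ t ∈ Icc 0 L, |t - x| ≤ (P n).mesh →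
      dist (f n t) (g x) < δ := by
  have huc := isCompact_Icc.uniformContinuousOn_of_continuous hg
  obtain ⟨r, hr, hr'⟩ := Metric.uniformContinuousOn_iff.1 huc (δ / 2) (half_pos hδ)
  filter_upwards [Metric.tendstoUniformlyOn_iff.1 hfg (δ / 2) (half_pos hδ),
    hP.eventually_lt_const hr] with n h1 h2 x hx t ht htx
  have h3 := h1 t ht
  have h4 := hr' t ht x hx (by rw [Real.dist_eq]; linarith)
  rw [dist_comm] at h3
  linarith [dist_triangle (f n t) (g t) (g x)]

theorem eventually_avg_sub_le {P : ℕ → Partition L}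
    (hP : Tendsto (fun n => (P n).mesh) atTop (𝓝 0))
    {v : ℕ → ℝ → E} (hv : ∀ n, Continuous (v n)) {w : ℝ → E}
    (hw : Continuous w) (h : TendstoUniformlyOn v w atTop (Icc 0 L)) {δ : ℝ} (hδ : 0 < δ) :
    ∀ᶠ n in atTop, ∀ᵐ x ∂(intervalMeasure L), ‖(P n).avg (v n) x - w x‖ ≤ δ := by
  filter_upwards [eventually_dist_lt_of_mesh hP h hw.continuousOn hδ] with n hn
  filter_upwards [(P n).ae_mem_element] with x ⟨i, hi⟩
  rw [(P n).avg_of_mem _ hi]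
  refine (P n).norm_mean_sub_le (hv n) fun t ht => ?_
  rw [← dist_eq_norm]
  refine (hn x ((P n).element_subset i (Ioo_subset_Icc_self hi)) t ((P n).element_subset i ht)
    ?_).le
  have := (P n).length_le_mesh i
  rw [abs_le]
  constructor <;> linarith [ht.1, ht.2, hi.1, hi.2]

theorem tendsto_integral_interp {P : ℕ → Partition L}
    (hP : Tendsto (fun n => (P n).mesh) atTop (𝓝 0))
    (hL : 0 < L) {f : ℕ → ℝ → ℝ} {g : ℝ → ℝ} (hg : Continuous g)
    (h : TendstoUniformlyOn f g atTop (Icc 0 L)) :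
    Tendsto (fun n => ∫ x in Ioo 0 L, (P n).interp (f n) x) atTop (𝓝 (∫ x in Ioo 0 L, g x)) := by
  have hgi : Integrable g (intervalMeasure L) :=
    (hg.continuousOn.integrableOn_compact (isCompact_Icc (a := 0) (b := L))).mono_set
      Ioo_subset_Icc_self
  rw [Metric.tendsto_nhds]
  intro δ hδ
  have hη : 0 < δ / (2 * L) := by positivity
  filter_upwards [eventually_dist_lt_of_mesh hP h hg.continuousOn hη] with n hn
  have hb : ∀ᵐ x ∂(intervalMeasure L), ‖(P n).interp (f n) x - g x‖ ≤ δ / (2 * L) := by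
    filter_upwards [(P n).ae_mem_element] with x ⟨i, hi⟩
    have hm := (P n).length_le_mesh i
    have hx := (P n).element_subset i (Ioo_subset_Icc_self hi)
    refine (P n).abs_interp_sub_le _ hi ?_ ?_
    · refine (hn x hx _ ((P n).left_mem i) ?_).le
      rw [abs_le]
      constructor <;> linarith [hi.1, hi.2]
    · refine (hn x hx _ ((P n).right_mem i) ?_).le
      rw [abs_le]
      constructor <;> linarith [hi.1, hi.2]
  have hd : Integrable (fun x => (P n).interp (f n) x - g x) (intervalMeasure L) :=
    Integrable.of_bound (((P n).measurable_interp _).sub hg.measurable).aestronglyMeasurable _ hb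
  have hi : Integrable ((P n).interp (f n)) (intervalMeasure L) :=
    (hd.add hgi).congr (Eventually.of_forall fun x => sub_add_cancel _ _)
  rw [dist_eq_norm, ← integral_sub hi hgi]
  refine (norm_integral_le_of_norm_le_const hb).trans_lt ?_
  have hμ : (intervalMeasure L).real univ = L := by
    simp [measureReal_def, hL.le]
  rw [hμ]
  field_simp
  norm_num

/-! ### Energies as norms of operators -/

theorem theta_nonneg {κ : ℝ} (hκ : 0 < κ) : 0 ≤ theta κ := le_min (by positivity) zero_le_one

theorem theta_le_one (κ : ℝ) : theta κ ≤ 1 := min_le_right _ _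

theorem theta_le (κ : ℝ) : theta κ ≤ κ / 2 := min_le_left _ _

theorem continuous_dy (p : RodSpace L) : Continuous (RodSpace.dy p) := continuous_rep _ _

theorem continuous_b (p : RodSpace L) : Continuous (RodSpace.b p) := continuous_rep _ _

/-- The constant of the embedding `H¹ ⊆ C⁰` on `[0, L]`. -/
def embeddingConst (L : ℝ) : ℝ := L⁻¹ * √L + √L

theorem norm_cross_le_of_norm_le_one {u v : E} {M : ℝ} (hu : ‖u‖ ≤ M) (hv : ‖v‖ ≤ 1) :
    ‖cross u v‖ ≤ M := by
  refine (norm_cross_le u v).trans ?_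
  nlinarith [norm_nonneg u, norm_nonneg v]

/-- Multiplication by the director, `v ↦ b · v`, for a director of length at most one. -/
def bendOp (p : RodSpace L) (hb : ∀ x ∈ Icc 0 L, ‖RodSpace.b p x‖ ≤ 1) :
    L2 L →L[ℝ] Lp ℝ 2 (intervalMeasure L) :=
  innerMul (RodSpace.b p) (continuous_b p).measurable 1 fun x hx => hb x (Ioo_subset_Icc_self hx)

/-- The torsion operator `w ↦ (y' × b) · w`. -/
def torsionOp (hL : 0 < L) (p : RodSpace L) (hb : ∀ x ∈ Icc 0 L, ‖RodSpace.b p x‖ ≤ 1) :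
    L2 L →L[ℝ] Lp ℝ 2 (intervalMeasure L) :=
  innerMul (fun x => cross (RodSpace.dy p x) (RodSpace.b p x))
    (continuous_cross.comp ((continuous_dy p).prodMk (continuous_b p))).measurable
    (embeddingConst L * ‖p.1‖) fun x hx =>
      norm_cross_le_of_norm_le_one (norm_rep_le hL p.1 1 (Ioo_subset_Icc_self hx))
        (hb x (Ioo_subset_Icc_self hx))

/-- Multiplication by the elementwise averaged director, `v ↦ Q b · v`. -/
def bendOpAvg (P : Partition L) (p : RodSpace L) (hb : ∀ x ∈ Icc 0 L, ‖RodSpace.b p x‖ ≤ 1) :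
    L2 L →L[ℝ] Lp ℝ 2 (intervalMeasure L) :=
  innerMul (P.avg (RodSpace.b p)) (P.measurable_avg _) 1 fun x _ =>
    P.norm_avg_le (continuous_b p) zero_le_one hb x

/-- The torsion operator `w ↦ (y' × Q b) · w` with the elementwise averaged director. -/
def torsionOpAvg (hL : 0 < L) (P : Partition L) (p : RodSpace L)
    (hb : ∀ x ∈ Icc 0 L, ‖RodSpace.b p x‖ ≤ 1) :
    L2 L →L[ℝ] Lp ℝ 2 (intervalMeasure L) :=
  innerMul (fun x => cross (RodSpace.dy p x) (P.avg (RodSpace.b p) x))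
    (continuous_cross.measurable.comp ((continuous_dy p).measurable.prodMk (P.measurable_avg _)))
    (embeddingConst L * ‖p.1‖) fun x hx =>
      norm_cross_le_of_norm_le_one (norm_rep_le hL p.1 1 (Ioo_subset_Icc_self hx))
        (P.norm_avg_le (continuous_b p) zero_le_one hb x)

/-- The penalty integral `∫ 𝓘[(y' · b)²]`. -/
def penalty (P : Partition L) (p : RodSpace L) : ℝ :=
  ∫ x in Ioo 0 L, P.interp (fun t => inner ℝ (RodSpace.dy p t) (RodSpace.b p t) ^ 2) x

theorem penalty_nonneg (P : Partition L) (p : RodSpace L) : 0 ≤ penalty P p :=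
  P.integral_interp_nonneg fun _ => sq_nonneg _

theorem discreteEnergy_eq (hL : 0 < L) (κ : ℝ) (P : Partition L) (ε : ℝ) (p : RodSpace L)
    (hb : ∀ x ∈ Icc 0 L, ‖RodSpace.b p x‖ ≤ 1) :
    discreteEnergy κ P ε p =
      (κ / 2 * ‖p.1.1 2‖ ^ 2 - theta κ / 2 * ‖bendOpAvg P p hb (p.1.1 2)‖ ^ 2)
      + theta κ / 2 * ‖p.2.1 1‖ ^ 2
      + (1 - theta κ) / 2 * ‖torsionOpAvg hL P p hb (p.2.1 1)‖ ^ 2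
      + 1 / (2 * ε) * penalty P p := by
  have h1 : (∫ x in Ioo 0 L, ‖RodSpace.ddy p x‖ ^ 2) = ‖p.1.1 2‖ ^ 2 := integral_norm_sq_eq _
  have h2 : (∫ x in Ioo 0 L, ‖RodSpace.db p x‖ ^ 2) = ‖p.2.1 1‖ ^ 2 := integral_norm_sq_eq _
  have h3 : (∫ x in Ioo 0 L, inner ℝ (P.avg (RodSpace.b p) x) (RodSpace.ddy p x) ^ 2)
      = ‖bendOpAvg P p hb (p.1.1 2)‖ ^ 2 := integral_inner_sq_eq _ _ _
  have h4 : (∫ x in Ioo 0 L, inner ℝ (RodSpace.db p x)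
        (cross (RodSpace.dy p x) (P.avg (RodSpace.b p) x)) ^ 2)
      = ‖torsionOpAvg hL P p hb (p.2.1 1)‖ ^ 2 := by
    simp only [real_inner_comm (cross _ _)]
    exact integral_inner_sq_eq _ _ _
  rw [discreteEnergy, h1, h2, h3, h4, penalty]
  ring

/-- The weak derivative is the derivative almost everywhere. -/
theorem ae_hasDerivAt_rep (hL : 0 < L) {k : ℕ} (u : Sobolev L k) (j : Fin k) :
    ∀ᵐ x ∂(intervalMeasure L), HasDerivAt (rep u j) (weakD u j.succ x) x := by
  have hi : IntervalIntegrable (weakD u j.succ) volume 0 L :=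
    intervalIntegrable_of_integrable (integrable_L2 (u.1 j.succ)) (left_mem_Icc.2 hL.le)
      (right_mem_Icc.2 hL.le)
  rw [ae_restrict_iff' measurableSet_Ioo]
  filter_upwards [hi.ae_hasDerivAt_integral] with x hx hx'
  have h := (hx (by rw [uIcc_of_le hL.le]; exact Ioo_subset_Icc_self hx') 0 (by simp)).const_add
    (rep u j 0)
  refine h.congr_of_eventuallyEq ?_
  filter_upwards [Ioo_mem_nhds hx'.1 hx'.2] with s hs
  exact rep_eq_primitive hL u j (Ioo_subset_Icc_self hs)

/-- For an admissible rod the constraints determine two of the three components of `b'` in the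
frame `y'`, `b`, `y' × b`: `b · b' = 0` and `y' · b' = - b · y''`. -/
theorem norm_db_sq_eq (hL : 0 < L) {p : RodSpace L} (hp : ∀ x ∈ Icc 0 L,
    ‖RodSpace.dy p x‖ = 1 ∧ ‖RodSpace.b p x‖ = 1 ∧
      inner ℝ (RodSpace.dy p x) (RodSpace.b p x) = 0) :
    ∀ᵐ x ∂(intervalMeasure L), ‖RodSpace.db p x‖ ^ 2 =
      inner ℝ (RodSpace.b p x) (RodSpace.ddy p x) ^ 2
      + inner ℝ (cross (RodSpace.dy p x) (RodSpace.b p x)) (RodSpace.db p x) ^ 2 := by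
  filter_upwards [ae_hasDerivAt_rep hL p.1 1, ae_hasDerivAt_rep hL p.2 0,
    ae_restrict_mem measurableSet_Ioo] with x h1 h2 hx
  change HasDerivAt (RodSpace.dy p) (RodSpace.ddy p x) x at h1
  change HasDerivAt (RodSpace.b p) (RodSpace.db p x) x at h2
  obtain ⟨ht, hb, htb⟩ := hp x (Ioo_subset_Icc_self hx)
  have hnhds := Ioo_mem_nhds hx.1 hx.2
  have e1 : inner ℝ (RodSpace.b p x) (RodSpace.db p x) = 0 := by
    have hd := h2.inner ℝ h2
    have hc : HasDerivAt (fun t => inner ℝ (RodSpace.b p t) (RodSpace.b p t)) 0 x := by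
      refine (hasDerivAt_const x (1 : ℝ)).congr_of_eventuallyEq ?_
      filter_upwards [hnhds] with s hs
      rw [real_inner_self_eq_norm_sq, (hp s (Ioo_subset_Icc_self hs)).2.1, one_pow]
    have := hd.unique hc
    rw [real_inner_comm (RodSpace.b p x)] at this
    linarith
  have e2 : inner ℝ (RodSpace.dy p x) (RodSpace.db p x)
      = - inner ℝ (RodSpace.b p x) (RodSpace.ddy p x) := by
    have hd := h1.inner ℝ h2
    have hc : HasDerivAt (fun t => inner ℝ (RodSpace.dy p t) (RodSpace.b p t)) 0 x := by
      refine (hasDerivAt_const x (0 : ℝ)).congr_of_eventuallyEq ?_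
      filter_upwards [hnhds] with s hs
      exact (hp s (Ioo_subset_Icc_self hs)).2.2
    have := hd.unique hc
    rw [real_inner_comm (RodSpace.b p x)] at this
    linarith
  rw [norm_sq_eq_frame ht hb htb, e1, e2, real_inner_comm (cross _ _)]
  ring

/-- On the admissible class the limit of the discrete quadratic forms is the bending-torsion
energy. -/
theorem rodEnergy_eq (hL : 0 < L) (κ : ℝ) {p : RodSpace L} (hp : ∀ x ∈ Icc 0 L,
    ‖RodSpace.dy p x‖ = 1 ∧ ‖RodSpace.b p x‖ = 1 ∧
      inner ℝ (RodSpace.dy p x) (RodSpace.b p x) = 0)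
    (hb : ∀ x ∈ Icc 0 L, ‖RodSpace.b p x‖ ≤ 1) :
    rodEnergy κ p = (κ / 2 * ‖p.1.1 2‖ ^ 2 - theta κ / 2 * ‖bendOp p hb (p.1.1 2)‖ ^ 2)
      + theta κ / 2 * ‖p.2.1 1‖ ^ 2
      + (1 - theta κ) / 2 * ‖torsionOp hL p hb (p.2.1 1)‖ ^ 2 := by
  have h1 : (∫ x in Ioo 0 L, ‖RodSpace.ddy p x‖ ^ 2) = ‖p.1.1 2‖ ^ 2 := integral_norm_sq_eq _
  have h4 : (∫ x in Ioo 0 L, inner ℝ (RodSpace.db p x)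
        (cross (RodSpace.dy p x) (RodSpace.b p x)) ^ 2)
      = ‖torsionOp hL p hb (p.2.1 1)‖ ^ 2 := by
    simp only [real_inner_comm (cross _ _)]
    exact integral_inner_sq_eq _ _ _
  have h5 : ‖p.2.1 1‖ ^ 2 = ‖bendOp p hb (p.1.1 2)‖ ^ 2 + ‖torsionOp hL p hb (p.2.1 1)‖ ^ 2 := by
    rw [← integral_norm_sq_eq (bendOp p hb (p.1.1 2)),
      ← integral_norm_sq_eq (torsionOp hL p hb (p.2.1 1)), ← integral_norm_sq_eq (p.2.1 1),
      ← integral_add (Lp.memLp _).integrable_norm_pow' (Lp.memLp _).integrable_norm_pow']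
    refine integral_congr_ae ?_
    filter_upwards [norm_db_sq_eq hL hp, coeFn_innerMul (continuous_b p).measurable
      (fun x hx => hb x (Ioo_subset_Icc_self hx)) (p.1.1 2),
      coeFn_innerMul (continuous_cross.comp ((continuous_dy p).prodMk (continuous_b p))).measurable
      (fun x hx => norm_cross_le_of_norm_le_one (norm_rep_le hL p.1 1 (Ioo_subset_Icc_self hx))
        (hb x (Ioo_subset_Icc_self hx))) (p.2.1 1)] with x hx1 hx2 hx3
    refine Eq.trans hx1 ?_
    rw [bendOp, torsionOp]
    congr 1
    · rw [Real.norm_eq_abs, sq_abs, hx2]; rfl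
    · rw [Real.norm_eq_abs, sq_abs]
      exact congrArg (· ^ 2) hx3.symm
  rw [rodEnergy, h1, h4, h5]
  ring

/-! ### Limits of the operators -/

theorem WeakTendsto.centerline {p : ℕ → RodSpace L} {q : RodSpace L} (h : WeakTendsto p q) :
    WeakTendsto (fun n => (p n).1) q.1 :=
  h.map (ContinuousLinearMap.fst ℝ (Sobolev L 2) (Sobolev L 1))

theorem WeakTendsto.director {p : ℕ → RodSpace L} {q : RodSpace L} (h : WeakTendsto p q) :
    WeakTendsto (fun n => (p n).2) q.2 :=
  h.map (ContinuousLinearMap.snd ℝ (Sobolev L 2) (Sobolev L 1))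

section

variable {P : ℕ → Partition L} {p : ℕ → RodSpace L} {q : RodSpace L}
  (hb : ∀ n, ∀ x ∈ Icc 0 L, ‖RodSpace.b (p n) x‖ ≤ 1)
  (hq : ∀ x ∈ Icc 0 L, ‖RodSpace.b q x‖ ≤ 1)

theorem tendsto_bendOpAvg (hL : 0 < L) (hP : Tendsto (fun n => (P n).mesh) atTop (𝓝 0))
    (h : WeakTendsto p q) :
    Tendsto (fun n => bendOpAvg (P n) (p n) (hb n)) atTop (𝓝 (bendOp q hq)) :=
  tendsto_innerMul _ _ _ _ fun _ hδ => eventually_avg_sub_le hP (fun n => continuous_b (p n))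
    (continuous_b q) (tendstoUniformlyOn_rep hL h.director 0) hδ

theorem tendsto_torsionOpAvg (hL : 0 < L) (hP : Tendsto (fun n => (P n).mesh) atTop (𝓝 0))
    (h : WeakTendsto p q) :
    Tendsto (fun n => torsionOpAvg hL (P n) (p n) (hb n)) atTop (𝓝 (torsionOp hL q hq)) := by
  refine tendsto_innerMul _ _ _ _ fun δ hδ => ?_
  set M := embeddingConst L * ‖q.1‖ with hM
  have hM0 : 0 ≤ M := mul_nonneg (by unfold embeddingConst; positivity) (norm_nonneg _)
  have hη : 0 < δ / (2 * (M + 1)) := by positivity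
  filter_upwards [eventually_avg_sub_le hP (fun n => continuous_b (p n)) (continuous_b q)
      (tendstoUniformlyOn_rep hL h.director 0) hη,
    Metric.tendstoUniformlyOn_iff.1 (tendstoUniformlyOn_rep hL h.centerline 1) (δ / 2)
      (half_pos hδ)] with n h1 h2
  filter_upwards [h1, ae_restrict_mem measurableSet_Ioo] with x h1 hx
  have hx' := Ioo_subset_Icc_self hx
  have h3 := h2 x hx'
  rw [dist_comm, dist_eq_norm] at h3
  change ‖RodSpace.dy (p n) x - RodSpace.dy q x‖ < δ / 2 at h3
  have h4 : ‖RodSpace.dy q x‖ ≤ M := norm_rep_le hL q.1 1 hx'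
  have h5 := (P n).norm_avg_le (continuous_b (p n)) zero_le_one (hb n) x
  rw [cross_sub_cross]
  refine (norm_add_le_of_le (norm_cross_le_of_norm_le_one h3.le h5) (norm_cross_le _ _)).trans ?_
  have h6 : ‖RodSpace.dy q x‖ * ‖(P n).avg (RodSpace.b (p n)) x - RodSpace.b q x‖
      ≤ (M + 1) * (δ / (2 * (M + 1))) := by
    gcongr
    linarith
  have h7 : (M + 1) * (δ / (2 * (M + 1))) = δ / 2 := by field_simp
  linarith

end

/-! ### The lower bound -/

/-- A director of unit length at the nodes is at most of unit length in between, by convexity. -/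
theorem norm_b_le_one {P : Partition L} {p : RodSpace L}
    (h : P.IsPiecewisePoly 1 (RodSpace.b p)) (h1 : ∀ j, ‖RodSpace.b p (P.node j)‖ = 1) :
    ∀ x ∈ Icc 0 L, ‖RodSpace.b p x‖ ≤ 1 := fun _ hx =>
  P.norm_le_of_isPiecewisePoly_one h (fun j => (h1 j).le) hx

theorem tendsto_boundaryPoints (hL : 0 < L) {p : ℕ → RodSpace L} {q : RodSpace L}
    (h : WeakTendsto p q) :
    Tendsto (fun n => boundaryPoints (p n)) atTop (𝓝 (boundaryPoints q)) := by
  have h0 : (0 : ℝ) ∈ Icc 0 L := left_mem_Icc.2 hL.le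
  have h1 : L ∈ Icc 0 L := right_mem_Icc.2 hL.le
  have e {k : ℕ} {u : ℕ → Sobolev L k} {v : Sobolev L k} (hu : WeakTendsto u v) (j : Fin k) {x : ℝ}
      (hx : x ∈ Icc 0 L) : Tendsto (fun n => rep (u n) j x) atTop (𝓝 (rep v j x)) :=
    (hu.map (evalCLM hL j hx)).tendsto_of_finiteDimensional
  rw [tendsto_pi_nhds]
  intro i
  fin_cases i
  · exact e h.centerline 0 h0
  · exact e h.centerline 0 h1
  · exact e h.centerline 1 h0
  · exact e h.centerline 1 h1
  · exact e h.director 0 h0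
  · exact e h.director 0 h1

/-- The boundary conditions are closed; `Y` carries no topology, so coordinates are used. -/
theorem map_eq_of_tendsto {Y : Type*} [AddCommGroup Y] [Module ℝ Y] [FiniteDimensional ℝ Y]
    (Λ : (Fin 6 → E) →ₗ[ℝ] Y) {ℓ : Y} {u : ℕ → Fin 6 → E} {v : Fin 6 → E}
    (h : Tendsto u atTop (𝓝 v)) (hu : ∀ n, Λ (u n) = ℓ) : Λ v = ℓ := by
  let e := Module.finBasis ℝ Y |>.equivFun
  have hc : Continuous (e.toLinearMap ∘ₗ Λ) := LinearMap.continuous_of_finiteDimensional _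
  have := (hc.tendsto v).comp h
  have h2 : Tendsto (fun _ : ℕ => e ℓ) atTop (𝓝 (e (Λ v))) := by
    refine this.congr fun n => ?_
    simp [hu n]
  exact (e.injective (tendsto_nhds_unique h2 tendsto_const_nhds))

/-- Unit length at the nodes becomes unit length everywhere in the limit of vanishing mesh size. -/
theorem norm_eq_one_of_nodes {P : ℕ → Partition L}
    (hP : Tendsto (fun n => (P n).mesh) atTop (𝓝 0)) {f : ℕ → ℝ → E} {g : ℝ → E}
    (hfg : TendstoUniformlyOn f g atTop (Icc 0 L)) (hg : Continuous g)
    (h1 : ∀ n j, ‖f n ((P n).node j)‖ = 1) {x : ℝ} (hx : x ∈ Icc 0 L) : ‖g x‖ = 1 := by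
  refine eq_of_forall_dist_le fun δ hδ => ?_
  obtain ⟨n, hn⟩ := (eventually_dist_lt_of_mesh hP hfg hg.continuousOn hδ).exists
  obtain ⟨j, hj⟩ := (P n).exists_node_near hx
  have := hn x hx _ ((P n).node_mem j) hj
  rw [Real.dist_eq, ← h1 n j, abs_sub_comm]
  rw [dist_eq_norm] at this
  exact (abs_norm_sub_norm_le _ _).trans this.le

/-- A continuous map preserves uniform convergence to a continuous limit on a compact set: it is
uniformly continuous on a compact neighbourhood of the range of the limit. -/
theorem tendstoUniformlyOn_comp_continuous {F G : Type*} [MetricSpace F] [ProperSpace F]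
    [MetricSpace G] {f : ℕ → ℝ → F} {g : ℝ → F} {K : Set ℝ} (hK : IsCompact K)
    (hg : ContinuousOn g K) (h : TendstoUniformlyOn f g atTop K) {Φ : F → G} (hΦ : Continuous Φ) :
    TendstoUniformlyOn (fun n x => Φ (f n x)) (fun x => Φ (g x)) atTop K := by
  have hc : IsCompact (Metric.cthickening 1 (g '' K)) := (hK.image_of_continuousOn hg).cthickening
  refine UniformContinuousOn.comp_tendstoUniformlyOn_eventually
    (s := Metric.cthickening 1 (g '' K)) ?_ ?_
    (hc.uniformContinuousOn_of_continuous hΦ.continuousOn) h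
  · filter_upwards [Metric.tendstoUniformlyOn_iff.1 h 1 one_pos] with n hn x hx
    refine Metric.mem_cthickening_of_dist_le _ (g x) _ _ (mem_image_of_mem g hx) ?_
    rw [dist_comm]
    exact (hn x hx).le
  · exact fun x hx => Metric.self_subset_cthickening _ (mem_image_of_mem g hx)

/-- The penalty integrals converge to `∫ (y' · b)²`. -/
theorem tendsto_penalty (hL : 0 < L) {P : ℕ → Partition L}
    (hP : Tendsto (fun n => (P n).mesh) atTop (𝓝 0)) {p : ℕ → RodSpace L} {q : RodSpace L}
    (h : WeakTendsto p q) : Tendsto (fun n => penalty (P n) (p n)) atTop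
      (𝓝 (∫ x in Ioo 0 L, inner ℝ (RodSpace.dy q x) (RodSpace.b q x) ^ 2)) := by
  have h1 : TendstoUniformlyOn (fun n x => (RodSpace.dy (p n) x, RodSpace.b (p n) x))
      (fun x => (RodSpace.dy q x, RodSpace.b q x)) atTop (Icc 0 L) := by
    rw [Metric.tendstoUniformlyOn_iff]
    intro δ hδ
    filter_upwards [Metric.tendstoUniformlyOn_iff.1 (tendstoUniformlyOn_rep hL h.centerline 1) δ hδ,
      Metric.tendstoUniformlyOn_iff.1 (tendstoUniformlyOn_rep hL h.director 0) δ hδ]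
      with n h1 h2 x hx
    exact max_lt (h1 x hx) (h2 x hx)
  have hΦ : Continuous fun z : E × E => inner ℝ z.1 z.2 ^ 2 :=
    (continuous_fst.inner continuous_snd).pow 2
  have h2 := tendstoUniformlyOn_comp_continuous isCompact_Icc
    ((continuous_dy q).prodMk (continuous_b q)).continuousOn h1 hΦ
  exact tendsto_integral_interp hP hL (((continuous_dy q).inner (continuous_b q)).pow 2) h2

/-- Compactness and lower semicontinuity: the weak limit of discretely admissible rods with
discrete energies at most `c` is admissible and has energy at most `c`. -/
theorem admissible_and_rodEnergy_le (hL : 0 < L) {κ : ℝ} (hκ : 0 < κ) {Y : Type*} [AddCommGroup Y]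
    [Module ℝ Y] [FiniteDimensional ℝ Y] (Λ : (Fin 6 → E) →ₗ[ℝ] Y) (ℓ : Y)
    {P : ℕ → Partition L} (hP : Tendsto (fun n => (P n).mesh) atTop (𝓝 0))
    {ε : ℕ → ℝ} (hε : ∀ n, 0 < ε n) (hε0 : Tendsto ε atTop (𝓝 0)) {p : ℕ → RodSpace L}
    {q : RodSpace L} (h : WeakTendsto p q) (hp : ∀ n, p n ∈ DiscreteAdmissible Λ ℓ (P n)) {c : ℝ}
    (hc : ∀ n, discreteEnergy κ (P n) (ε n) (p n) ≤ c) :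
    q ∈ Admissible Λ ℓ ∧ rodEnergy κ q ≤ c := by
  have hθ0 := theta_nonneg hκ
  have hθ1 := theta_le_one κ
  have hθ2 := theta_le κ
  have hb : ∀ n, ∀ x ∈ Icc 0 L, ‖RodSpace.b (p n) x‖ ≤ 1 := fun n =>
    norm_b_le_one (hp n).1.2 fun j => ((hp n).2.2 j).2
  have hdy1 : ∀ x ∈ Icc 0 L, ‖RodSpace.dy q x‖ = 1 := fun x hx =>
    norm_eq_one_of_nodes hP (tendstoUniformlyOn_rep hL h.centerline 1) (continuous_dy q)
      (fun n j => ((hp n).2.2 j).1) hx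
  have hb1 : ∀ x ∈ Icc 0 L, ‖RodSpace.b q x‖ = 1 := fun x hx =>
    norm_eq_one_of_nodes hP (tendstoUniformlyOn_rep hL h.director 0) (continuous_b q)
      (fun n j => ((hp n).2.2 j).2) hx
  have hq : ∀ x ∈ Icc 0 L, ‖RodSpace.b q x‖ ≤ 1 := fun x hx => (hb1 x hx).le
  have hv : WeakTendsto (fun n => (p n).1.1 2) (q.1.1 2) := h.centerline.map (componentCLM L 2)
  have hw : WeakTendsto (fun n => (p n).2.1 1) (q.2.1 1) := h.director.map (componentCLM L 1)
  have hS := tendsto_bendOpAvg hb hq hL hP h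
  have hR := tendsto_torsionOpAvg hb hq hL hP h
  have hS1 : ∀ n, ‖bendOpAvg (P n) (p n) (hb n)‖ ≤ 1 := fun n => norm_innerMul_le _ zero_le_one _
  obtain ⟨e1, he1, he1'⟩ := hv.exists_lower_bound_sub hS hS1 (a := κ / 2) (c := theta κ / 2)
    (by linarith) (by linarith)
  obtain ⟨e2, he2, he2'⟩ := hw.exists_lower_bound_map
    (tendsto_const_nhds (x := ContinuousLinearMap.id ℝ (L2 L)))
  obtain ⟨e3, he3, he3'⟩ := hw.exists_lower_bound_map hR
  have hpen : ∀ n, 0 ≤ 1 / (2 * ε n) * penalty (P n) (p n) := fun n =>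
    mul_nonneg (by have := hε n; positivity) (penalty_nonneg _ _)
  -- the discrete energy without the penalty is nonnegative, so that `penalty ≤ 2 ε c`
  have horth : ∀ x ∈ Icc 0 L, inner ℝ (RodSpace.dy q x) (RodSpace.b q x) = 0 := by
    have hlim := tendsto_penalty hL hP h
    have hle : ∀ n, penalty (P n) (p n) ≤ 2 * ε n * c := by
      intro n
      have hen := hc n
      rw [discreteEnergy_eq hL κ (P n) (ε n) (p n) (hb n)] at hen
      have h1 : ‖bendOpAvg (P n) (p n) (hb n) ((p n).1.1 2)‖ ^ 2 ≤ ‖(p n).1.1 2‖ ^ 2 := by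
        gcongr
        simpa using (bendOpAvg (P n) (p n) (hb n)).le_of_opNorm_le (hS1 n) ((p n).1.1 2)
      have h2 : theta κ / 2 * ‖bendOpAvg (P n) (p n) (hb n) ((p n).1.1 2)‖ ^ 2
          ≤ κ / 2 * ‖(p n).1.1 2‖ ^ 2 :=
        mul_le_mul (by linarith) h1 (sq_nonneg _) (by linarith)
      have h3 : 0 ≤ theta κ / 2 * ‖(p n).2.1 1‖ ^ 2 := by positivity
      have h4 : 0 ≤ (1 - theta κ) / 2 * ‖torsionOpAvg hL (P n) (p n) (hb n) ((p n).2.1 1)‖ ^ 2 :=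
        mul_nonneg (by linarith) (sq_nonneg _)
      have h5 : 1 / (2 * ε n) * penalty (P n) (p n) ≤ c := by linarith
      have h6 := hε n
      rw [one_div, inv_mul_le_iff₀ (by positivity)] at h5
      exact h5
    have h0 : Tendsto (fun n => 2 * ε n * c) atTop (𝓝 0) := by
      simpa using (hε0.const_mul 2).mul_const c
    have hcont : Continuous fun x => inner ℝ (RodSpace.dy q x) (RodSpace.b q x) ^ 2 :=
      ((continuous_dy q).inner (continuous_b q)).pow 2
    have hint : Integrable (fun x => inner ℝ (RodSpace.dy q x) (RodSpace.b q x) ^ 2)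
        (intervalMeasure L) :=
      (hcont.continuousOn.integrableOn_compact (isCompact_Icc (a := 0) (b := L))).mono_set
        Ioo_subset_Icc_self
    have hz : ∫ x in Ioo 0 L, inner ℝ (RodSpace.dy q x) (RodSpace.b q x) ^ 2 = 0 :=
      le_antisymm (le_of_tendsto_of_tendsto' hlim h0 hle) (integral_nonneg fun _ => sq_nonneg _)
    rw [integral_eq_zero_iff_of_nonneg (fun _ => sq_nonneg _) hint] at hz
    intro x hx
    have := eqOn_Icc_of_ae_eq_Ioo hL hcont.continuousOn continuousOn_const hz hx
    exact pow_eq_zero_iff two_ne_zero |>.1 this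
  have hadm : ∀ x ∈ Icc 0 L, ‖RodSpace.dy q x‖ = 1 ∧ ‖RodSpace.b q x‖ = 1 ∧
      inner ℝ (RodSpace.dy q x) (RodSpace.b q x) = 0 := fun x hx =>
    ⟨hdy1 x hx, hb1 x hx, horth x hx⟩
  refine ⟨⟨map_eq_of_tendsto Λ (tendsto_boundaryPoints hL h) fun n => (hp n).2.1, hadm⟩, ?_⟩
  rw [rodEnergy_eq hL κ hadm hq]
  refine le_of_tendsto' ((he1'.add (he2'.const_mul (theta κ / 2))).add
    (he3'.const_mul ((1 - theta κ) / 2))) fun n => ?_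
  refine le_trans ?_ (hc n)
  rw [discreteEnergy_eq hL κ (P n) (ε n) (p n) (hb n)]
  have h1 := he1 n
  have h2 : theta κ / 2 * e2 n ≤ theta κ / 2 * ‖(p n).2.1 1‖ ^ 2 :=
    mul_le_mul_of_nonneg_left (he2 n) (by linarith)
  have h3 := mul_le_mul_of_nonneg_left (he3 n) (a := (1 - theta κ) / 2) (by linarith)
  linarith [hpen n]

/-! ### Sobolev functions from their highest derivative -/

theorem memLp_of_continuousOn_Icc {f : ℝ → E} (hf : ContinuousOn f (Icc 0 L)) :
    MemLp f 2 (intervalMeasure L) := by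
  obtain ⟨C, hC⟩ := isCompact_Icc.exists_bound_of_continuousOn hf
  refine MemLp.of_bound
    ((hf.mono Ioo_subset_Icc_self).aestronglyMeasurable measurableSet_Ioo) C ?_
  rw [ae_restrict_iff' measurableSet_Ioo]
  exact Eventually.of_forall fun x hx => hC x (Ioo_subset_Icc_self hx)

theorem continuousOn_const_add_primitive (a : E) (g : L2 L) :
    ContinuousOn (fun x => a + ∫ t in 0..x, g t) (Icc 0 L) :=
  continuousOn_const.add (continuousOn_primitive_L2 g)

/-- The antiderivative of `g` with value `a` at `0`, as an element of `L²`. -/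
def antideriv (a : E) (g : L2 L) : L2 L :=
  (memLp_of_continuousOn_Icc (continuousOn_const_add_primitive a g)).toLp

theorem coeFn_antideriv (a : E) (g : L2 L) :
    antideriv a g =ᵐ[intervalMeasure L] fun x => a + ∫ t in 0..x, g t :=
  MemLp.coeFn_toLp _

theorem norm_le_of_ae_bound_Ioo (hL : 0 < L) (f : L2 L) {C : ℝ} (hC : 0 ≤ C)
    (h : ∀ᵐ x ∂(intervalMeasure L), ‖f x‖ ≤ C) : ‖f‖ ≤ √L * C := by
  have := Lp.norm_le_of_ae_bound hC h
  have hμ : ((measureUnivNNReal (intervalMeasure L) : NNReal) : ℝ) = L := by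
    change ((intervalMeasure L) univ).toReal = L
    simp [hL.le]
  rwa [hμ, show ((2 : ℝ≥0∞).toReal⁻¹) = 1 / 2 by norm_num,
    ← Real.sqrt_eq_rpow] at this

theorem norm_antideriv_sub_le (hL : 0 < L) (a : E) (f g : L2 L) :
    ‖antideriv a f - antideriv a g‖ ≤ L * ‖f - g‖ := by
  have h := norm_le_of_ae_bound_Ioo hL (antideriv a f - antideriv a g) (C := √L * ‖f - g‖)
    (by positivity) ?_
  · rwa [← mul_assoc, Real.mul_self_sqrt hL.le] at h
  filter_upwards [Lp.coeFn_sub (antideriv a f) (antideriv a g), coeFn_antideriv a f,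
    coeFn_antideriv a g, ae_restrict_mem measurableSet_Ioo] with x h1 h2 h3 hx
  have h0 : (0 : ℝ) ∈ Icc 0 L := left_mem_Icc.2 hL.le
  have hx' := Ioo_subset_Icc_self hx
  have e : (∫ t in 0..x, f t) - ∫ t in 0..x, g t = ∫ t in 0..x, (f - g : L2 L) t := by
    rw [← intervalIntegral.integral_sub (intervalIntegrable_of_integrable (integrable_L2 f) h0 hx')
      (intervalIntegrable_of_integrable (integrable_L2 g) h0 hx')]
    exact intervalIntegral_congr_ae_Ioo (Lp.coeFn_sub f g).symm h0 hx'
  rw [h1, Pi.sub_apply, h2, h3, add_sub_add_left_eq_sub, e]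
  refine (norm_intervalIntegral_le (f - g) h0 hx').trans ?_
  gcongr
  rw [sub_zero, abs_of_pos hx.1]
  exact hx.2.le

theorem tendsto_antideriv (hL : 0 < L) (a : E) {g : ℕ → L2 L} {g₀ : L2 L}
    (h : Tendsto g atTop (𝓝 g₀)) :
    Tendsto (fun n => antideriv a (g n)) atTop (𝓝 (antideriv a g₀)) := by
  rw [tendsto_iff_norm_sub_tendsto_zero] at h ⊢
  refine squeeze_zero (fun _ => norm_nonneg _) (fun n => norm_antideriv_sub_le hL a _ _) ?_
  simpa using h.const_mul L

theorem hasWeakDeriv_const (hL : 0 < L) (a : E) : HasWeakDeriv L (fun _ => a) 0 := by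
  intro φ h1 _ h3
  have hz : ∀ x, x ∉ Ioo 0 L → φ x = 0 := fun x hx =>
    image_eq_zero_of_notMem_tsupport fun h => hx (h3 h)
  have : ∫ x in 0..L, deriv φ x = φ L - φ 0 :=
    intervalIntegral.integral_deriv_eq_sub (fun x _ => (h1.differentiable (by simp)) x)
      ((h1.continuous_deriv (by simp)).intervalIntegrable _ _)
  rw [hz 0 (by simp), hz L (by simp), sub_zero, intervalIntegral.integral_of_le hL.le,
    integral_Ioc_eq_integral_Ioo] at this
  rw [integral_smul_const, this]
  simp

theorem hasWeakDeriv_antideriv (hL : 0 < L) (a : E) (g : L2 L) :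
    HasWeakDeriv L (antideriv a g) g := by
  have hi : Integrable (fun x => ∫ t in 0..x, g t) (intervalMeasure L) :=
    ((continuousOn_primitive_L2 g).integrableOn_compact isCompact_Icc).mono_set Ioo_subset_Icc_self
  refine ((hasWeakDeriv_const hL a).add (hasWeakDeriv_primitive hL (integrable_L2 g) hi)
    (integrable_const a) (integrable_zero _ _ _) hi (integrable_L2 g)).congr_ae
    (coeFn_antideriv a g) ?_
  rw [zero_add]

/-- Every component of a Sobolev function but the top one is the antiderivative of the next. -/
theorem component_eq_antideriv (hL : 0 < L) {k : ℕ} (u : Sobolev L k) (j : Fin k) :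
    u.1 j.castSucc = antideriv (rep u j 0) (u.1 j.succ) := by
  refine Lp.ext ?_
  filter_upwards [weakD_ae_eq_rep u j, coeFn_antideriv (rep u j 0) (u.1 j.succ),
    ae_restrict_mem measurableSet_Ioo] with x h1 h2 hx
  rw [h2]
  exact h1.trans (rep_eq_primitive hL u j (Ioo_subset_Icc_self hx))

/-- The element of `H¹` with initial value `a` and derivative `g`. -/
def ofDeriv (hL : 0 < L) (a : E) (g : L2 L) : Sobolev L 1 :=
  ⟨WithLp.toLp 2 ![antideriv a g, g], fun i => by
    fin_cases i
    exact hasWeakDeriv_antideriv hL a g⟩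

/-- The element of `H²` with initial values `c`, `a` of the function and its derivative, and second
derivative `g`. -/
def ofDeriv₂ (hL : 0 < L) (c a : E) (g : L2 L) : Sobolev L 2 :=
  ⟨WithLp.toLp 2 ![antideriv c (antideriv a g), antideriv a g, g], fun i => by
    fin_cases i
    · exact hasWeakDeriv_antideriv hL c (antideriv a g)
    · exact hasWeakDeriv_antideriv hL a g⟩

theorem tendsto_ofDeriv (hL : 0 < L) (u : Sobolev L 1) {g : ℕ → L2 L}
    (h : Tendsto g atTop (𝓝 (u.1 1))) :
    Tendsto (fun n => ofDeriv hL (rep u 0 0) (g n)) atTop (𝓝 u) := by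
  rw [tendsto_subtype_rng]
  have hu : u.1 = WithLp.toLp 2 ![antideriv (rep u 0 0) (u.1 1), u.1 1] := by
    ext1 i
    fin_cases i
    · exact component_eq_antideriv hL u 0
    · rfl
  rw [hu]
  refine ((PiLp.continuous_toLp 2 _).tendsto _).comp (tendsto_pi_nhds.2 fun i => ?_)
  fin_cases i
  · exact tendsto_antideriv hL _ h
  · exact h

theorem tendsto_ofDeriv₂ (hL : 0 < L) (u : Sobolev L 2) {g : ℕ → L2 L}
    (h : Tendsto g atTop (𝓝 (u.1 2))) :
    Tendsto (fun n => ofDeriv₂ hL (rep u 0 0) (rep u 1 0) (g n)) atTop (𝓝 u) := by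
  rw [tendsto_subtype_rng]
  have h1 : u.1 1 = antideriv (rep u 1 0) (u.1 2) := component_eq_antideriv hL u 1
  have h0 : u.1 0 = antideriv (rep u 0 0) (antideriv (rep u 1 0) (u.1 2)) := by
    rw [← h1]; exact component_eq_antideriv hL u 0
  have hu : u.1 = WithLp.toLp 2 ![antideriv (rep u 0 0) (antideriv (rep u 1 0) (u.1 2)),
      antideriv (rep u 1 0) (u.1 2), u.1 2] := by
    ext1 i
    fin_cases i
    · exact h0
    · exact h1
    · rfl
  rw [hu]
  refine ((PiLp.continuous_toLp 2 _).tendsto _).comp (tendsto_pi_nhds.2 fun i => ?_)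
  fin_cases i
  · exact tendsto_antideriv hL _ (tendsto_antideriv hL _ h)
  · exact tendsto_antideriv hL _ h
  · exact h

theorem rep_eq_of_component_eq_antideriv (hL : 0 < L) {k : ℕ} (u : Sobolev L k) (j : Fin k) {a : E}
    {g : L2 L} (h : u.1 j.castSucc = antideriv a g) {x : ℝ} (hx : x ∈ Icc 0 L) :
    rep u j x = a + ∫ t in 0..x, g t := by
  refine eqOn_Icc_of_ae_eq_Ioo hL (continuous_rep u j).continuousOn
    (continuousOn_const_add_primitive a g) ?_ hx
  filter_upwards [weakD_ae_eq_rep u j, coeFn_antideriv a g] with x h1 h2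
  rw [← h1, ← h2]
  exact congrArg (fun f : L2 L => f x) h

theorem rep_ofDeriv (hL : 0 < L) (a : E) (g : L2 L) {x : ℝ} (hx : x ∈ Icc 0 L) :
    rep (ofDeriv hL a g) 0 x = a + ∫ t in 0..x, g t :=
  rep_eq_of_component_eq_antideriv hL _ 0 rfl hx

theorem rep_ofDeriv₂_one (hL : 0 < L) (c a : E) (g : L2 L) {x : ℝ} (hx : x ∈ Icc 0 L) :
    rep (ofDeriv₂ hL c a g) 1 x = a + ∫ t in 0..x, g t :=
  rep_eq_of_component_eq_antideriv hL _ 1 rfl hx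

theorem rep_ofDeriv₂_zero (hL : 0 < L) (c a : E) (g : L2 L) {x : ℝ} (hx : x ∈ Icc 0 L) :
    rep (ofDeriv₂ hL c a g) 0 x = c + ∫ t in 0..x, (a + ∫ s in 0..t, g s) := by
  rw [rep_eq_of_component_eq_antideriv hL (ofDeriv₂ hL c a g) 0 (g := antideriv a g) rfl hx]
  rw [intervalIntegral_congr_ae_Ioo (coeFn_antideriv a g) (left_mem_Icc.2 hL.le) hx]

/-! ### Elementwise polynomials in `L²` -/

/-- The function that equals the polynomial with coefficients `c i` on the `i`-th open element. -/
def polyFun (P : Partition L) (d : ℕ) (c : Fin P.N → Fin (d + 1) → E) (x : ℝ) : E :=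
  ∑ i, (Ioo (P.left i) (P.right i)).indicator (fun t => ∑ k : Fin (d + 1), t ^ (k : ℕ) • c i k) x

theorem polyFun_of_mem (P : Partition L) {d : ℕ} (c : Fin P.N → Fin (d + 1) → E) {i : Fin P.N}
    {x : ℝ} (hx : x ∈ Ioo (P.left i) (P.right i)) :
    polyFun P d c x = ∑ k : Fin (d + 1), x ^ (k : ℕ) • c i k :=
  P.sum_indicator_of_mem _ hx

theorem memLp_polyFun (P : Partition L) (d : ℕ) (c : Fin P.N → Fin (d + 1) → E) :
    MemLp (polyFun P d c) 2 (intervalMeasure L) := by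
  refine memLp_finsetSum _ fun i _ => MemLp.indicator measurableSet_Ioo ?_
  exact memLp_of_continuousOn_Icc (by fun_prop)

/-- The `L²` class of an elementwise polynomial function, as a linear map of the coefficients. -/
def polyMap (P : Partition L) (d : ℕ) : (Fin P.N → Fin (d + 1) → E) →ₗ[ℝ] L2 L where
  toFun c := (memLp_polyFun P d c).toLp
  map_add' c c' := by
    rw [← MemLp.toLp_add]
    refine MemLp.toLp_congr _ _ ?_
    filter_upwards [P.ae_mem_element] with x ⟨i, hi⟩
    rw [Pi.add_apply, polyFun_of_mem P _ hi, polyFun_of_mem P _ hi, polyFun_of_mem P _ hi]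
    simp [smul_add, Finset.sum_add_distrib]
  map_smul' r c := by
    rw [RingHom.id_apply, ← MemLp.toLp_const_smul]
    refine MemLp.toLp_congr _ _ ?_
    filter_upwards [P.ae_mem_element] with x ⟨i, hi⟩
    rw [Pi.smul_apply, polyFun_of_mem P _ hi, polyFun_of_mem P _ hi]
    simp [Finset.smul_sum, smul_comm r]

theorem coeFn_polyMap (P : Partition L) (d : ℕ) (c : Fin P.N → Fin (d + 1) → E) :
    polyMap P d c =ᵐ[intervalMeasure L] polyFun P d c :=
  (memLp_polyFun P d c).coeFn_toLp

/-- The `L²`-orthogonal projection onto the elementwise polynomials of degree at most `d`. -/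
theorem exists_projection (P : Partition L) (d : ℕ) (w : L2 L) :
    ∃ c, (∀ e, inner ℝ (w - polyMap P d c) (polyMap P d e) = 0) ∧
      ∀ e, ‖w - polyMap P d c‖ ≤ ‖w - polyMap P d e‖ := by
  set V := LinearMap.range (polyMap P d) with hV
  obtain ⟨c, hc⟩ := V.starProjection_apply_mem w
  have horth : ∀ e, inner ℝ (w - polyMap P d c) (polyMap P d e) = 0 := fun e => by
    rw [hc]; exact Submodule.starProjection_inner_eq_zero w _ ⟨e, rfl⟩
  refine ⟨c, horth, fun e => ?_⟩
  refine le_of_sq_le_sq ?_ (norm_nonneg _)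
  have h1 : w - polyMap P d e = (w - polyMap P d c) + polyMap P d (c - e) := by
    rw [map_sub]; abel
  rw [h1, norm_add_sq_real, horth]
  nlinarith [sq_nonneg ‖polyMap P d (c - e)‖]

/-- The projection of `w` onto elementwise polynomials of degree at most `d`. -/
def proj (P : Partition L) (d : ℕ) (w : L2 L) : L2 L := polyMap P d (exists_projection P d w).choose

theorem inner_sub_proj (P : Partition L) (d : ℕ) (w : L2 L) (e : Fin P.N → Fin (d + 1) → E) :
    inner ℝ (w - proj P d w) (polyMap P d e) = 0 := (exists_projection P d w).choose_spec.1 e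

theorem norm_sub_proj_le (P : Partition L) (d : ℕ) (w : L2 L) (e : Fin P.N → Fin (d + 1) → E) :
    ‖w - proj P d w‖ ≤ ‖w - polyMap P d e‖ := (exists_projection P d w).choose_spec.2 e

theorem proj_ae_eq (P : Partition L) (d : ℕ) (w : L2 L) :
    ∃ c : Fin P.N → Fin (d + 1) → E, proj P d w =ᵐ[intervalMeasure L] polyFun P d c :=
  ⟨_, coeFn_polyMap P d _⟩

theorem sum_pow_smul_single_zero {d : ℕ} (x : ℝ) (z : E) :
    ∑ k : Fin (d + 1), x ^ (k : ℕ) • (Pi.single 0 z : Fin (d + 1) → E) k = z := by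
  rw [Finset.sum_eq_single 0]
  · simp
  · intro k _ hk
    rw [Pi.single_eq_of_ne hk, smul_zero]
  · simp

/-- The projections converge to the projected function as the mesh size tends to zero. -/
theorem tendsto_proj (hL : 0 < L) {P : ℕ → Partition L}
    (hP : Tendsto (fun n => (P n).mesh) atTop (𝓝 0)) (d : ℕ) (w : L2 L) :
    Tendsto (fun n => proj (P n) d w) atTop (𝓝 w) := by
  rw [Metric.tendsto_nhds]
  intro δ hδ
  obtain ⟨f, hf, hf'⟩ := (Lp.memLp w).exists_boundedContinuous_eLpNorm_sub_le (by simp)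
    (ε := ENNReal.ofReal (δ / 2)) (by simpa using hδ)
  have h1 : ‖w - hf'.toLp‖ ≤ δ / 2 := by
    rw [Lp.norm_def, eLpNorm_congr_ae (g := (w : ℝ → E) - (f : ℝ → E)) ?_]
    · exact ENNReal.toReal_le_of_le_ofReal (by positivity) hf
    · filter_upwards [Lp.coeFn_sub w hf'.toLp, hf'.coeFn_toLp] with x h1 h2
      rw [h1, Pi.sub_apply, Pi.sub_apply, h2]
  have hη : 0 < δ / (4 * √L) := by positivity
  filter_upwards [eventually_dist_lt_of_mesh hP (f := fun _ => f) (g := f)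
    (by
      rw [Metric.tendstoUniformlyOn_iff]
      intro η hη
      filter_upwards with n x hx
      simpa using hη) f.continuous.continuousOn hη] with n hn
  set e : Fin (P n).N → Fin (d + 1) → E := fun i => Pi.single 0 (f ((P n).left i)) with he
  have h2 : ‖hf'.toLp - polyMap (P n) d e‖ ≤ √L * (δ / (4 * √L)) := by
    refine norm_le_of_ae_bound_Ioo hL _ hη.le ?_
    filter_upwards [(P n).ae_mem_element, coeFn_polyMap (P n) d e, hf'.coeFn_toLp,
      Lp.coeFn_sub hf'.toLp (polyMap (P n) d e)] with x ⟨i, hi⟩ h3 h4 h5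
    rw [h5, Pi.sub_apply, h3, h4, polyFun_of_mem _ _ hi, he, sum_pow_smul_single_zero,
      ← dist_eq_norm, dist_comm]
    refine (hn x ((P n).element_subset i (Ioo_subset_Icc_self hi)) _ ((P n).left_mem i) ?_).le
    have := (P n).length_le_mesh i
    rw [abs_le]
    constructor <;> linarith [hi.1, hi.2]
  have h3 : √L * (δ / (4 * √L)) = δ / 4 := by
    have : 0 < √L := by positivity
    field_simp
  rw [dist_comm, dist_eq_norm]
  refine (norm_sub_proj_le _ _ _ e).trans_lt ?_
  have e1 : w - polyMap (P n) d e = (w - hf'.toLp) + (hf'.toLp - polyMap (P n) d e) := by abel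
  rw [e1]
  refine (norm_add_le_of_le h1 h2).trans_lt ?_
  rw [h3]; linarith

/-- The projection has the same mean value as the function on every element. -/
theorem integral_element_sub_proj (P : Partition L) (d : ℕ) (w : L2 L) (i : Fin P.N) :
    ∫ t in (P.left i)..(P.right i), (w - proj P d w : L2 L) t = 0 := by
  refine ext_inner_right ℝ fun z => ?_
  rw [inner_zero_left, ← inner_sub_proj P d w (Pi.single i (Pi.single 0 z)),
    intervalIntegral_eq_setIntegral_Ioo _ (P.left_mem i).1 (P.left_lt_right i).le (P.right_mem i).2,
    L2.inner_def, real_inner_comm, ← integral_inner (integrable_L2 _).integrableOn z,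
    ← integral_indicator measurableSet_Ioo]
  refine integral_congr_ae ?_
  filter_upwards [P.ae_mem_element, coeFn_polyMap P d (Pi.single i (Pi.single 0 z))]
    with x ⟨j, hj⟩ h1
  rw [h1, polyFun_of_mem _ _ hj]
  by_cases hij : j = i
  · subst hij
    rw [indicator_of_mem hj, Pi.single_eq_same, sum_pow_smul_single_zero, real_inner_comm]
  · rw [indicator_of_notMem fun h => hij (P.element_unique hj h), Pi.single_eq_of_ne hij]
    simp

theorem integral_node_sub_proj (P : Partition L) (d : ℕ) (w : L2 L) (j : Fin (P.N + 1)) :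
    ∫ t in 0..(P.node j), (w - proj P d w : L2 L) t = 0 := by
  induction j using Fin.induction with
  | zero => rw [P.node_zero, intervalIntegral.integral_same]
  | succ i ih =>
    change ∫ t in 0..(P.right i), (w - proj P d w : L2 L) t = 0
    rw [← intervalIntegral_add_adjacent _ (P.left_mem i) (P.right_mem i)]
    change (∫ t in 0..(P.node i.castSucc), (w - proj P d w : L2 L) t) + _ = 0
    rw [ih, integral_element_sub_proj, add_zero]

/-- Primitives of `w` and of its projection agree at the nodes, as indicator functions of elements
are admissible test functions for the projection. -/
theorem integral_node_proj (hL : 0 < L) (P : Partition L) (d : ℕ) (w : L2 L) (j : Fin (P.N + 1)) :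
    ∫ t in 0..(P.node j), proj P d w t = ∫ t in 0..(P.node j), w t := by
  have h := integral_node_sub_proj P d w j
  have h0 : (0 : ℝ) ∈ Icc 0 L := left_mem_Icc.2 hL.le
  rw [intervalIntegral_congr_ae_Ioo (Lp.coeFn_sub w _) h0 (P.node_mem j)] at h
  simp only [Pi.sub_apply] at h
  rw [intervalIntegral.integral_sub
    (intervalIntegrable_of_integrable (integrable_L2 w) h0 (P.node_mem j))
    (intervalIntegrable_of_integrable (integrable_L2 _) h0 (P.node_mem j)), sub_eq_zero] at h
  exact h.symm

/-- Integration by parts: if `∫ f = 0` and `∫ x f(x) dx = 0`, then the primitive of `f` has mean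
value zero. -/
theorem integral_primitive_eq_zero (hL : 0 < L) {f : ℝ → ℝ} (hf : Integrable f (intervalMeasure L))
    (h0 : ∫ t in 0..L, f t = 0) (h1 : ∫ t in 0..L, f t * t = 0) :
    ∫ x in 0..L, ∫ t in 0..x, f t = 0 := by
  have hi : IntervalIntegrable f volume 0 L :=
    intervalIntegrable_of_integrable hf (left_mem_Icc.2 hL.le) (right_mem_Icc.2 hL.le)
  have hF := hi.absolutelyContinuousOnInterval_intervalIntegral (c := 0) (by simp)
  have hG : AbsolutelyContinuousOnInterval (fun x : ℝ => x) 0 L :=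
    contDiff_id.contDiffOn.absolutelyContinuousOnInterval
  have := hF.integral_mul_deriv_eq_deriv_mul hG
  simp only [deriv_id'', mul_one, h0, zero_mul, mul_zero, sub_zero, zero_sub] at this
  rw [this, neg_eq_zero]
  refine Eq.trans (intervalIntegral.integral_congr_ae ?_) h1
  filter_upwards [hi.ae_hasDerivAt_integral] with x hx hx'
  rw [(hx (uIoc_subset_uIcc hx') 0 (by simp)).deriv]

/-- For the projection onto elementwise affine functions the double primitives of `w` and of its
projection agree at `L`: the function `x` is an admissible test function. -/
theorem integral_primitive_sub_proj (hL : 0 < L) (P : Partition L) (w : L2 L) :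
    ∫ x in 0..L, ∫ t in 0..x, (w - proj P 1 w : L2 L) t = 0 := by
  set f : L2 L := w - proj P 1 w with hf
  have h0 : (0 : ℝ) ∈ Icc 0 L := left_mem_Icc.2 hL.le
  have hLm : L ∈ Icc 0 L := right_mem_Icc.2 hL.le
  have hfi : ∀ x ∈ Icc 0 L, IntervalIntegrable f volume 0 x := fun x hx =>
    intervalIntegrable_of_integrable (integrable_L2 f) h0 hx
  have hFi : IntervalIntegrable (fun x => ∫ t in 0..x, f t) volume 0 L := by
    have := (continuousOn_primitive_L2 f)
    rw [← uIcc_of_le hL.le] at this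
    exact this.intervalIntegrable
  have hcomm : ∀ (z : E) (g : ℝ → E) (x : ℝ), IntervalIntegrable g volume 0 x →
      ∫ t in 0..x, inner ℝ z (g t) = inner ℝ z (∫ t in 0..x, g t) := fun z g x hg =>
    ContinuousLinearMap.intervalIntegral_comp_comm (μ := volume) (f := g) (innerSL ℝ z) hg
  refine ext_inner_left ℝ fun z => ?_
  rw [inner_zero_right, ← hcomm z _ L hFi]
  have e : ∫ x in 0..L, inner ℝ z (∫ t in 0..x, f t) =
      ∫ x in 0..L, ∫ t in 0..x, inner ℝ z (f t) := by
    refine intervalIntegral.integral_congr fun x hx => ?_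
    rw [uIcc_of_le hL.le] at hx
    exact (hcomm z f x (hfi x hx)).symm
  rw [e]
  refine integral_primitive_eq_zero hL ((integrable_L2 f).const_inner z) ?_ ?_
  · rw [hcomm z f L (hfi L hLm)]
    have := integral_node_sub_proj P 1 w (Fin.last _)
    rw [P.node_last] at this
    rw [this, inner_zero_right]
  · refine Eq.trans ?_ (inner_sub_proj P 1 w (fun _ => Pi.single 1 z))
    rw [L2.inner_def, intervalIntegral.integral_of_le hL.le, integral_Ioc_eq_integral_Ioo, ← hf]
    refine integral_congr_ae ?_
    filter_upwards [P.ae_mem_element, coeFn_polyMap P 1 (fun _ => Pi.single 1 z)] with x ⟨i, hi⟩ h1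
    rw [h1, polyFun_of_mem _ _ hi, Fin.sum_univ_two]
    simp [inner_smul_right, real_inner_comm, mul_comm]

/-- Integrating an elementwise polynomial raises its degree by one. -/
theorem exists_poly_of_weakD (hL : 0 < L) {k d : ℕ} (u : Sobolev L k) (j : Fin k) {l r : ℝ}
    (hl : l ∈ Icc 0 L) (hr : r ∈ Icc 0 L) {c : Fin (d + 1) → E}
    (h : ∀ᵐ x ∂(intervalMeasure L), x ∈ Ioo l r →
      weakD u j.succ x = ∑ m : Fin (d + 1), x ^ (m : ℕ) • c m) :
    ∃ c' : Fin (d + 1 + 1) → E, ∀ x ∈ Icc l r,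
      rep u j x = ∑ m : Fin (d + 1 + 1), x ^ (m : ℕ) • c' m := by
  refine ⟨Fin.cons (rep u j l - ∑ m : Fin (d + 1), (l ^ ((m : ℕ) + 1) / ((m : ℕ) + 1)) • c m)
    fun m => ((1 : ℝ) / ((m : ℕ) + 1)) • c m, fun x hx => ?_⟩
  have hx' : x ∈ Icc 0 L := ⟨hl.1.trans hx.1, hx.2.trans hr.2⟩
  have h1 : ∫ t in l..x, weakD u j.succ t
      = ∫ t in l..x, ∑ m : Fin (d + 1), t ^ (m : ℕ) • c m := by
    refine intervalIntegral.integral_congr_ae ?_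
    have h2 := (compl_mem_ae_iff (μ := (volume : Measure ℝ)) (s := {r})).2 (by simp)
    filter_upwards [(ae_restrict_iff' measurableSet_Ioo).1 h, h2] with t ht hne htm
    rw [uIoc_of_le hx.1] at htm
    have hlt : t < r := lt_of_le_of_ne (htm.2.trans hx.2) hne
    exact ht ⟨hl.1.trans_lt htm.1, hlt.trans_le hr.2⟩ ⟨htm.1, hlt⟩
  have h2 : ∫ t in l..x, ∑ m : Fin (d + 1), t ^ (m : ℕ) • c m
      = ∑ m : Fin (d + 1), ((x ^ ((m : ℕ) + 1) - l ^ ((m : ℕ) + 1)) / ((m : ℕ) + 1)) • c m := by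
    rw [intervalIntegral.integral_finsetSum]
    · simp only [intervalIntegral.integral_smul_const, integral_pow]
    · intro m _
      exact Continuous.intervalIntegrable (by fun_prop) _ _
  have h3 : rep u j x = rep u j l + ∫ t in l..x, weakD u j.succ t := by
    rw [← rep_sub_rep hL u j hl hx']; abel
  rw [h3, h1, h2]
  refine Eq.symm ((Fin.sum_univ_succ _).trans ?_)
  simp only [Fin.cons_zero, Fin.cons_succ, Fin.val_zero, pow_zero, one_smul, Fin.val_succ,
    smul_smul, mul_one_div, sub_div, sub_smul, Finset.sum_sub_distrib]
  abel

/-! ### Recovery sequences -/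

/-- The interpolant of a rod: the highest derivatives are projected onto elementwise affine
(centerline) and elementwise constant (director) functions and integrated. -/
def interpolant (hL : 0 < L) (P : Partition L) (q : RodSpace L) : RodSpace L :=
  (ofDeriv₂ hL (RodSpace.y q 0) (RodSpace.dy q 0) (proj P 1 (q.1.1 2)),
    ofDeriv hL (RodSpace.b q 0) (proj P 0 (q.2.1 1)))

theorem interpolant_dy_node (hL : 0 < L) (P : Partition L) (q : RodSpace L) (j : Fin (P.N + 1)) :
    RodSpace.dy (interpolant hL P q) (P.node j) = RodSpace.dy q (P.node j) := by
  refine (rep_ofDeriv₂_one hL _ _ _ (P.node_mem j)).trans ?_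
  rw [integral_node_proj hL]
  exact (rep_eq_primitive hL q.1 1 (P.node_mem j)).symm

theorem interpolant_b_node (hL : 0 < L) (P : Partition L) (q : RodSpace L) (j : Fin (P.N + 1)) :
    RodSpace.b (interpolant hL P q) (P.node j) = RodSpace.b q (P.node j) := by
  refine (rep_ofDeriv hL _ _ (P.node_mem j)).trans ?_
  rw [integral_node_proj hL]
  exact (rep_eq_primitive hL q.2 0 (P.node_mem j)).symm

theorem interpolant_y_zero (hL : 0 < L) (P : Partition L) (q : RodSpace L) :
    RodSpace.y (interpolant hL P q) 0 = RodSpace.y q 0 := by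
  refine (rep_ofDeriv₂_zero hL _ _ _ (left_mem_Icc.2 hL.le)).trans ?_
  simp

/-- The right boundary value of the centerline is preserved because the second derivative is
projected onto affine, and not only constant, functions. -/
theorem interpolant_y_right (hL : 0 < L) (P : Partition L) (q : RodSpace L) :
    RodSpace.y (interpolant hL P q) L = RodSpace.y q L := by
  have h0 : (0 : ℝ) ∈ Icc 0 L := left_mem_Icc.2 hL.le
  have hLm : L ∈ Icc 0 L := right_mem_Icc.2 hL.le
  set w : L2 L := q.1.1 2 with hw
  set g : L2 L := proj P 1 w with hg
  have hq : RodSpace.y q L = RodSpace.y q 0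
      + ∫ t in 0..L, (RodSpace.dy q 0 + ∫ s in 0..t, w s) := by
    refine (rep_eq_primitive hL q.1 0 hLm).trans (congrArg _ ?_)
    refine (intervalIntegral_congr_ae_Ioo (weakD_ae_eq_rep q.1 1) h0 hLm).trans ?_
    refine intervalIntegral.integral_congr fun t ht => ?_
    rw [uIcc_of_le hL.le] at ht
    exact rep_eq_primitive hL q.1 1 ht
  rw [hq]
  refine (rep_ofDeriv₂_zero hL _ _ _ hLm).trans (congrArg _ ?_)
  have hint (f : L2 L) :
      IntervalIntegrable (fun t => RodSpace.dy q 0 + ∫ s in 0..t, f s) volume 0 L := by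
    have := continuousOn_const_add_primitive (RodSpace.dy q 0) f
    rw [← uIcc_of_le hL.le] at this
    exact this.intervalIntegrable
  rw [eq_comm, ← sub_eq_zero, ← intervalIntegral.integral_sub (hint w) (hint g)]
  refine Eq.trans ?_ (integral_primitive_sub_proj hL P w)
  refine intervalIntegral.integral_congr fun t ht => ?_
  rw [uIcc_of_le hL.le] at ht
  simp only [add_sub_add_left_eq_sub]
  rw [← intervalIntegral.integral_sub (intervalIntegrable_of_integrable (integrable_L2 w) h0 ht)
    (intervalIntegrable_of_integrable (integrable_L2 g) h0 ht)]
  exact intervalIntegral_congr_ae_Ioo (Lp.coeFn_sub w g).symm h0 ht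

theorem boundaryPoints_interpolant (hL : 0 < L) (P : Partition L) (q : RodSpace L) :
    boundaryPoints (interpolant hL P q) = boundaryPoints q := by
  have d := interpolant_dy_node hL P q
  have b := interpolant_b_node hL P q
  have d0 := d 0
  have d1 := d (Fin.last _)
  have b0 := b 0
  have b1 := b (Fin.last _)
  rw [P.node_zero] at d0 b0
  rw [P.node_last] at d1 b1
  rw [boundaryPoints, boundaryPoints, d0, d1, b0, b1, interpolant_y_zero, interpolant_y_right]

theorem interpolant_mem_discreteSpace (hL : 0 < L) (P : Partition L) (q : RodSpace L) :
    interpolant hL P q ∈ discreteSpace P := by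
  constructor
  · intro i
    obtain ⟨c, hc⟩ := proj_ae_eq P 1 (q.1.1 2)
    obtain ⟨c₁, hc₁⟩ := exists_poly_of_weakD hL (interpolant hL P q).1 1 (P.left_mem i)
      (P.right_mem i) (c := c i) (by
        filter_upwards [hc] with x hx hxi
        rw [← polyFun_of_mem P c hxi, ← hx]
        rfl)
    refine exists_poly_of_weakD hL (interpolant hL P q).1 0 (P.left_mem i)
      (P.right_mem i) (c := c₁) ?_
    filter_upwards [weakD_ae_eq_rep (interpolant hL P q).1 1] with x hx hxi
    rw [← hc₁ x (Ioo_subset_Icc_self hxi), ← hx]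
    rfl
  · intro i
    obtain ⟨c, hc⟩ := proj_ae_eq P 0 (q.2.1 1)
    refine exists_poly_of_weakD hL (interpolant hL P q).2 0 (P.left_mem i)
      (P.right_mem i) (c := c i) ?_
    filter_upwards [hc] with x hx hxi
    rw [← polyFun_of_mem P c hxi, ← hx]
    rfl

theorem interpolant_mem_discreteAdmissible (hL : 0 < L) {Y : Type*} [AddCommGroup Y] [Module ℝ Y]
    {Λ : (Fin 6 → E) →ₗ[ℝ] Y} {ℓ : Y} (P : Partition L) {q : RodSpace L}
    (hq : q ∈ Admissible Λ ℓ) : interpolant hL P q ∈ DiscreteAdmissible Λ ℓ P := by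
  refine ⟨interpolant_mem_discreteSpace hL P q, ?_, fun j => ?_⟩
  · rw [boundaryPoints_interpolant]; exact hq.1
  · rw [interpolant_dy_node, interpolant_b_node]
    have := hq.2 _ (P.node_mem j)
    exact ⟨this.1, this.2.1⟩

/-- The interpolant keeps `y'` and `b` at the nodes, so it is not penalized, whatever `ε` is. -/
theorem penalty_interpolant (hL : 0 < L) (P : Partition L) {q : RodSpace L}
    (hq : ∀ x ∈ Icc 0 L, inner ℝ (RodSpace.dy q x) (RodSpace.b q x) = 0) :
    penalty P (interpolant hL P q) = 0 := by
  rw [penalty, P.interp_eq_zero fun j => ?_]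
  · simp
  · rw [interpolant_dy_node, interpolant_b_node, hq _ (P.node_mem j)]
    simp

theorem tendsto_interpolant (hL : 0 < L) {P : ℕ → Partition L}
    (hP : Tendsto (fun n => (P n).mesh) atTop (𝓝 0)) (q : RodSpace L) :
    Tendsto (fun n => interpolant hL (P n) q) atTop (𝓝 q) :=
  (tendsto_ofDeriv₂ hL q.1 (tendsto_proj hL hP 1 _)).prodMk_nhds
    (tendsto_ofDeriv hL q.2 (tendsto_proj hL hP 0 _))

/-- The interpolants of an admissible rod converge in energy. -/
theorem tendsto_discreteEnergy_interpolant (hL : 0 < L) (κ : ℝ) {Y : Type*} [AddCommGroup Y]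
    [Module ℝ Y] {Λ : (Fin 6 → E) →ₗ[ℝ] Y} {ℓ : Y} {P : ℕ → Partition L}
    (hP : Tendsto (fun n => (P n).mesh) atTop (𝓝 0)) (ε : ℕ → ℝ) {q : RodSpace L}
    (hq : q ∈ Admissible Λ ℓ) :
    Tendsto (fun n => discreteEnergy κ (P n) (ε n) (interpolant hL (P n) q)) atTop
      (𝓝 (rodEnergy κ q)) := by
  have hlim := tendsto_interpolant hL hP q
  have hweak := weakTendsto_of_tendsto hlim
  have hb : ∀ n, ∀ x ∈ Icc 0 L, ‖RodSpace.b (interpolant hL (P n) q) x‖ ≤ 1 := fun n =>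
    norm_b_le_one (interpolant_mem_discreteSpace hL (P n) q).2 fun j =>
      ((interpolant_mem_discreteAdmissible hL (P n) hq).2.2 j).2
  have hq1 : ∀ x ∈ Icc 0 L, ‖RodSpace.b q x‖ ≤ 1 := fun x hx => (hq.2 x hx).2.1.le
  have hS := tendsto_bendOpAvg hb hq1 hL hP hweak
  have hR := tendsto_torsionOpAvg hb hq1 hL hP hweak
  have hv : Tendsto (fun n => (interpolant hL (P n) q).1.1 2) atTop (𝓝 (q.1.1 2)) :=
    tendsto_proj hL hP 1 _
  have hw : Tendsto (fun n => (interpolant hL (P n) q).2.1 1) atTop (𝓝 (q.2.1 1)) :=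
    tendsto_proj hL hP 0 _
  rw [rodEnergy_eq hL κ hq.2 hq1]
  simp only [discreteEnergy_eq hL κ (P _) (ε _) _ (hb _),
    penalty_interpolant hL (P _) fun x hx => (hq.2 x hx).2.2, mul_zero, add_zero]
  exact ((((hv.norm.pow 2).const_mul _).sub
    (((tendsto_clm_apply hS hv).norm.pow 2).const_mul _)).add ((hw.norm.pow 2).const_mul _)).add
    (((tendsto_clm_apply hR hw).norm.pow 2).const_mul _)

end Rod

end

theorem proposition4p1 {L κ : ℝ} (hL : 0 < L) (hκ : 0 < κ)
    {Y : Type*} [AddCommGroup Y] [Module ℝ Y] [FiniteDimensional ℝ Y]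
    (Λ : (Fin 6 → Rod.E) →ₗ[ℝ] Y) (ℓ : Y)
    (P : ℕ → Rod.Partition L) (hP : Tendsto (fun n => (P n).mesh) atTop (𝓝 0))
    (ε : ℕ → ℝ) (hε : ∀ n, 0 < ε n) (hε0 : Tendsto ε atTop (𝓝 0)) :
    Rod.GammaConverges (X := WeakSpace ℝ (Rod.RodSpace L))
      (fun n p => Rod.IrodDiscrete κ Λ ℓ (P n) (ε n) ((toWeakSpace ℝ (Rod.RodSpace L)).symm p))
      (fun p => Rod.Irod κ Λ ℓ ((toWeakSpace ℝ (Rod.RodSpace L)).symm p)) := by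
  constructor
  · intro x u hu
    have hweak := Rod.weakTendsto_of_tendsto_weakSpace hu
    by_contra! hlt
    obtain ⟨c, hc1, hc2⟩ := EReal.lt_iff_exists_real_btwn.1 hlt
    -- along a subsequence the discrete energies stay below `c`
    obtain ⟨φ, hφ, hφc⟩ := extraction_of_frequently_atTop
      (frequently_lt_of_liminf_lt (by isBoundedDefault) hc1)
    have hmem : ∀ n, (toWeakSpace ℝ (Rod.RodSpace L)).symm (u (φ n)) ∈
        Rod.DiscreteAdmissible Λ ℓ (P (φ n)) := fun n => by
      by_contra h
      have := hφc n
      rw [Rod.IrodDiscrete, if_neg h] at this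
      exact not_top_lt this
    have hen : ∀ n, Rod.discreteEnergy κ (P (φ n)) (ε (φ n))
        ((toWeakSpace ℝ (Rod.RodSpace L)).symm (u (φ n))) ≤ c := fun n => by
      have := hφc n
      rw [Rod.IrodDiscrete, if_pos (hmem n), EReal.coe_lt_coe_iff] at this
      exact this.le
    obtain ⟨h1, h2⟩ := Rod.admissible_and_rodEnergy_le hL hκ Λ ℓ (hP.comp hφ.tendsto_atTop)
      (fun n => hε (φ n)) (hε0.comp hφ.tendsto_atTop) (hweak.comp hφ) hmem hen
    rw [Rod.Irod, if_pos h1, EReal.coe_lt_coe_iff] at hc2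
    exact hc2.not_ge h2
  · intro x
    set q := (toWeakSpace ℝ (Rod.RodSpace L)).symm x with hq
    by_cases h : q ∈ Rod.Admissible Λ ℓ
    · refine ⟨fun n => toWeakSpace ℝ (Rod.RodSpace L) (Rod.interpolant hL (P n) q), ?_, ?_⟩
      · have := ((toWeakSpaceCLM ℝ (Rod.RodSpace L)).continuous.tendsto q).comp
          (Rod.tendsto_interpolant hL hP q)
        exact this
      · have hE := (continuous_coe_real_ereal.tendsto _).comp
          (Rod.tendsto_discreteEnergy_interpolant hL κ hP ε h)
        have hval : ∀ n, Rod.IrodDiscrete κ Λ ℓ (P n) (ε n) ((toWeakSpace ℝ (Rod.RodSpace L)).symm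
            (toWeakSpace ℝ (Rod.RodSpace L) (Rod.interpolant hL (P n) q)))
            = (Rod.discreteEnergy κ (P n) (ε n) (Rod.interpolant hL (P n) q) : EReal) := fun n => by
          rw [LinearEquiv.symm_apply_apply, Rod.IrodDiscrete,
            if_pos (Rod.interpolant_mem_discreteAdmissible hL (P n) h)]
        simp only [hval]
        rw [Rod.Irod, if_pos h]
        exact hE.limsup_eq.le
    · refine ⟨fun _ => x, tendsto_const_nhds, ?_⟩
      simp only [Rod.Irod]
      rw [if_neg h]
      exact le_top
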